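/- For a locally compact (Hausdorff) group $G$ with left Haar measure $\mu$, let $\lambda$ be the left regular representation of $G$ on $L^2(G,\mu)$, $(\lambda(x)f)(y)=f(x^{-1}y)$, and let $\mathfrak M(G)\subseteq B(L^2(G,\mu))$ be the von Neumann algebra generated by $\lambda(G)$. The Fourier algebra $A(G)$ is the predual of $\mathfrak M(G)$, realized as an algebra of functions on $G$: it consists of the functions $u(x)=\omega(\lambda(x))$, $x\in G$, with $\omega$ a normal linear functional on $\mathfrak M(G)$, and $\|u\|_{A(G)}=\|\omega\|$. A continuous function $\varphi$ on $G$ is a multiplier of $A(G)$ if $\varphi\psi\in A(G)$ for all $\psi\in A(G)$; its completely bounded multiplier norm $\|\varphi\|_{M_0A(G)}$ is the completely bounded norm (possibly $\infty$) of the transpose $m_\varphi^*\colon\mathfrak M(G)\to\mathfrak M(G)$ of the operator $m_\varphi\colon\psi\mapsto\varphi\psi$ on $A(G)$. An approximate unit for $A(G)$ is a net $(\varphi_\alpha)$ in $A(G)$ with $\lim_\alpha\|\varphi_\alpha\psi-\psi\|_{A(G)}=0$ for all $\psi\in A(G)$. **Theorem.** Let $\Gamma$ be a lattice in a second countable locally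 compact group $G$, i.e. a closed discrete subgroup such that $G/\Gamma$ carries a non-zero bounded $G$-invariant measure, and let $k\in[1,\infty)$. Then the following conditions are equivalent. 1. $A(G)$ has an approximate unit $(\varphi_\alpha)$ such that $\|\varphi_\alpha\|_{M_0A(G)}\le k$ for all $\alpha$. 2. $A(\Gamma)$ has an approximate unit $(\psi_\alpha)$ such that $\|\psi_\alpha\|_{M_0A(\Gamma)}\le k$ for all $\alpha$, where $\Gamma$ is regarded as a discrete group with counting measure. -/

import Mathlib

open MeasureTheory Filter Topology
open scoped ENNReal

universe u

noncomputable section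

section FourierAlgebra

variable {G : Type u} [Group G] [MeasurableSpace G] [MeasurableMul G]

/-- The left regular representation on `L²(G, μ)`: `(λ(x) f)(y) = f(x⁻¹ y)`. -/
def leftRegular (μ : Measure G) [μ.IsMulLeftInvariant] (x : G) :
    Lp ℂ 2 μ →L[ℂ] Lp ℂ 2 μ :=
  (Lp.compMeasurePreservingₗᵢ ℂ (fun y => x⁻¹ * y)
    (measurePreserving_mul_left μ x⁻¹)).toContinuousLinearMap

/-- The group von Neumann algebra `M(G)`: the von Neumann algebra on `L²(G, μ)` generated by the
left regular representation, i.e. the double commutant of `{λ(x)} ∪ {λ(x)*}`. -/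
def groupVN (μ : Measure G) [μ.IsMulLeftInvariant] : VonNeumannAlgebra (Lp ℂ 2 μ) where
  toStarSubalgebra := StarSubalgebra.centralizer ℂ
    (StarSubalgebra.centralizer ℂ (Set.range (leftRegular μ)) :
      Set (Lp ℂ 2 μ →L[ℂ] Lp ℂ 2 μ))
  centralizer_centralizer' := by
    change Set.centralizer (Set.centralizer (Set.centralizer _)) = Set.centralizer _
    exact Set.centralizer_centralizer_centralizer _

/-- The elements of the group von Neumann algebra, with its operator norm. -/
abbrev GroupVN (μ : Measure G) [μ.IsMulLeftInvariant] : Type u :=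
  (groupVN μ).toStarSubalgebra

theorem leftRegular_mem_groupVN (μ : Measure G) [μ.IsMulLeftInvariant] (x : G) :
    leftRegular μ x ∈ (groupVN μ).toStarSubalgebra := by
  change leftRegular μ x ∈ StarSubalgebra.centralizer ℂ
    (StarSubalgebra.centralizer ℂ (Set.range (leftRegular μ)) :
      Set (Lp ℂ 2 μ →L[ℂ] Lp ℂ 2 μ))
  rw [← SetLike.mem_coe, StarSubalgebra.coe_centralizer_centralizer]
  exact Set.subset_centralizer_centralizer (Or.inl ⟨x, rfl⟩)

/-- `λ(x)` as an element of `M(G)`. -/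
def leftRegularVN (μ : Measure G) [μ.IsMulLeftInvariant] (x : G) : GroupVN μ :=
  ⟨leftRegular μ x, leftRegular_mem_groupVN μ x⟩

/-- A functional `ω` on `M(G)` is normal (σ-weakly continuous) if
`ω(T) = ∑ₙ ⟨T fₙ, gₙ⟩` with `∑ₙ ‖fₙ‖² < ∞` and `∑ₙ ‖gₙ‖² < ∞`. -/
def IsNormalFunctional {μ : Measure G} [μ.IsMulLeftInvariant] (ω : GroupVN μ →L[ℂ] ℂ) : Prop :=
  ∃ f g : ℕ → Lp ℂ 2 μ, Summable (fun n => ‖f n‖ ^ 2) ∧ Summable (fun n => ‖g n‖ ^ 2) ∧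
    ∀ T : GroupVN μ,
      HasSum (fun n => inner ℂ (g n) ((T : Lp ℂ 2 μ →L[ℂ] Lp ℂ 2 μ) (f n))) (ω T)

/-- The function `u` on `G` corresponds to the element `ω` of the predual of `M(G)`:
`ω` is normal and `u(x) = ω(λ(x))`. -/
def Represents {μ : Measure G} [μ.IsMulLeftInvariant] (ω : GroupVN μ →L[ℂ] ℂ) (u : G → ℂ) :
    Prop :=
  IsNormalFunctional ω ∧ ∀ x, u x = ω (leftRegularVN μ x)

/-- The Fourier algebra `A(G)`: the predual of `M(G)`, realized as functions on `G`. -/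
def fourierAlgebra (μ : Measure G) [μ.IsMulLeftInvariant] : Set (G → ℂ) :=
  {u | ∃ ω : GroupVN μ →L[ℂ] ℂ, Represents ω u}

/-- The norm of `A(G)`, i.e. the norm of the (unique) corresponding functional on `M(G)`;
it is `⊤` for functions outside `A(G)`. -/
def fourierNorm (μ : Measure G) [μ.IsMulLeftInvariant] (u : G → ℂ) : ℝ≥0∞ :=
  ⨅ (ω : GroupVN μ →L[ℂ] ℂ) (_ : Represents ω u), ‖ω‖ₑ

/-- An `n × n` matrix over `M(G)`, as an operator on the Hilbert space sum of `n` copies of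
`L²(G, μ)`. -/
def matrixOperator {μ : Measure G} [μ.IsMulLeftInvariant] {n : ℕ}
    (a : Matrix (Fin n) (Fin n) (GroupVN μ)) :
    PiLp 2 (fun _ : Fin n => Lp ℂ 2 μ) →L[ℂ] PiLp 2 (fun _ : Fin n => Lp ℂ 2 μ) :=
  ((PiLp.continuousLinearEquiv 2 ℂ (fun _ : Fin n => Lp ℂ 2 μ)).symm :
      (Fin n → Lp ℂ 2 μ) →L[ℂ] PiLp 2 (fun _ : Fin n => Lp ℂ 2 μ)) ∘L
    (ContinuousLinearMap.pi fun i => ∑ j,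
      (a i j : Lp ℂ 2 μ →L[ℂ] Lp ℂ 2 μ) ∘L
        ContinuousLinearMap.proj (R := ℂ) (φ := fun _ : Fin n => Lp ℂ 2 μ) j) ∘L
    ((PiLp.continuousLinearEquiv 2 ℂ (fun _ : Fin n => Lp ℂ 2 μ)) :
      PiLp 2 (fun _ : Fin n => Lp ℂ 2 μ) →L[ℂ] (Fin n → Lp ℂ 2 μ))

/-- The completely bounded norm of a linear map `S` on `M(G)`: the supremum over `n` of the norms
of `S ⊗ id` on `n × n` matrices. It is `⊤` if `S` is not completely bounded. -/
def cbNorm {μ : Measure G} [μ.IsMulLeftInvariant] (S : GroupVN μ →ₗ[ℂ] GroupVN μ) : ℝ≥0∞ :=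
  ⨆ (n : ℕ) (a : Matrix (Fin n) (Fin n) (GroupVN μ)) (_ : ‖matrixOperator a‖ ≤ 1),
    ‖matrixOperator (a.map S)‖ₑ

variable [TopologicalSpace G]

/-- `φ` is a multiplier of `A(G)`: it is continuous and `φ ψ ∈ A(G)` for every `ψ ∈ A(G)`. -/
def IsFourierMultiplier (μ : Measure G) [μ.IsMulLeftInvariant] (φ : G → ℂ) : Prop :=
  Continuous φ ∧ ∀ ψ ∈ fourierAlgebra μ, φ * ψ ∈ fourierAlgebra μ

/-- `S` is the transpose `m_φ*` of the operator `m_φ : ψ ↦ φ ψ` on `A(G)`: for `T ∈ M(G)` and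
`ψ ∈ A(G)`, `⟨S T, ψ⟩ = ⟨T, φ ψ⟩`. -/
def IsTransposeMultiplier {μ : Measure G} [μ.IsMulLeftInvariant] (φ : G → ℂ)
    (S : GroupVN μ →ₗ[ℂ] GroupVN μ) : Prop :=
  ∀ (ψ : G → ℂ) (ω ω' : GroupVN μ →L[ℂ] ℂ), Represents ω ψ → Represents ω' (φ * ψ) →
    ∀ T, ω (S T) = ω' T

/-- The completely bounded multiplier norm `‖φ‖_{M₀A(G)} = ‖m_φ*‖_cb`;
it is `⊤` for functions that are not completely bounded multipliers. -/
def cbMultiplierNorm (μ : Measure G) [μ.IsMulLeftInvariant] (φ : G → ℂ) : ℝ≥0∞ :=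
  ⨅ (_ : IsFourierMultiplier μ φ) (S : GroupVN μ →ₗ[ℂ] GroupVN μ)
    (_ : IsTransposeMultiplier φ S), cbNorm S

/-- `A(G)` has an approximate unit `(φ_α)` with `‖φ_α‖_{M₀A(G)} ≤ k` for all `α`: a net in `A(G)`
with `‖φ_α ψ - ψ‖_{A(G)} → 0` for all `ψ ∈ A(G)`. -/
def HasCBApproximateUnit (μ : Measure G) [μ.IsMulLeftInvariant] (k : ℝ) : Prop :=
  ∃ (ι : Type u) (_ : Preorder ι) (_ : IsDirectedOrder ι) (_ : Nonempty ι) (φ : ι → G → ℂ),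
    (∀ α, φ α ∈ fourierAlgebra μ) ∧
    (∀ ψ ∈ fourierAlgebra μ, Tendsto (fun α => fourierNorm μ (φ α * ψ - ψ)) atTop (𝓝 0)) ∧
    ∀ α, cbMultiplierNorm μ (φ α) ≤ ENNReal.ofReal k

end FourierAlgebra

/-- A lattice: a closed discrete subgroup `Γ` such that `G ⧸ Γ` has a non-zero bounded
`G`-invariant measure. -/
structure IsGroupLattice {G : Type u} [Group G] [TopologicalSpace G] [MeasurableSpace G]
    (Γ : Subgroup G) : Prop where
  isClosed : IsClosed (Γ : Set G)
  discrete : DiscreteTopology Γ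
  exists_measure : ∃ ν : Measure (G ⧸ Γ), ν ≠ 0 ∧ IsFiniteMeasure ν ∧
    SMulInvariantMeasure G (G ⧸ Γ) ν

end

noncomputable section

/-!
Both conditions say that on `Γ` the constant function `1` is a pointwise limit of finitely supported
functions of Herz–Schur norm at most `k`.

A completely bounded multiplier `φ` of `A(G)` is a Herz–Schur multiplier of the same norm: apply
`m_φ*` to matrices of translation operators. It restricts to `Γ`, and if `φ ∈ A(G)` it is a limit in
Herz–Schur norm of sums of coefficients of compactly supported vectors, whose restrictions to the
closed discrete subgroup `Γ` have finite support; a rescaling restores the bound `k`.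

Conversely let `D` be a Borel fundamental domain of finite measure for right translation by `Γ`. A
finitely supported `ψ` on `Γ` induces the function on `G` whose value at `x` is the average of `ψ σ`
over `z ∈ D`, where `D σ` is the tile containing `x z`. Cutting `L²(G)` along the tiles presents the
transposed multiplier on `M(G)` as a Schur multiplication by the kernel of `ψ`, which bounds its
completely bounded norm and, by dominated convergence, gives convergence to the identity against
normal functionals. Both passages apply to `Γ` itself, with the lattice `⊤` and the domain `{1}`.
-/

open scoped InnerProductSpace lp Pointwise

/-! ### Orthogonal families in Hilbert spaces -/

section OrthogonalFamilies

variable {𝕜 E ι : Type*} [RCLike 𝕜] [NormedAddCommGroup E] [InnerProductSpace 𝕜 E]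

theorem norm_inner_apply_le {F : Type*} [NormedAddCommGroup F] [InnerProductSpace 𝕜 F]
    (T : E →L[𝕜] F) (x : E) (y : F) : ‖⟪y, T x⟫_𝕜‖ ≤ ‖T‖ * (‖x‖ * ‖y‖) :=
  calc ‖⟪y, T x⟫_𝕜‖ ≤ ‖y‖ * (‖T‖ * ‖x‖) :=
        (norm_inner_le_norm _ _).trans (by gcongr; exact T.le_opNorm x)
    _ = ‖T‖ * (‖x‖ * ‖y‖) := by ring

theorem norm_sum_sq_of_orthogonal {s : Finset ι} {x : ι → E}
    (hx : (s : Set ι).Pairwise fun i j => ⟪x i, x j⟫_𝕜 = 0) :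
    ‖∑ i ∈ s, x i‖ ^ 2 = ∑ i ∈ s, ‖x i‖ ^ 2 := by
  have hinner : ⟪∑ i ∈ s, x i, ∑ i ∈ s, x i⟫_𝕜 = ∑ i ∈ s, ⟪x i, x i⟫_𝕜 := by
    rw [sum_inner]
    refine Finset.sum_congr rfl fun i hi => ?_
    rw [inner_sum, Finset.sum_eq_single_of_mem i hi fun j hj hji => hx hi hj hji.symm]
  simp only [inner_self_eq_norm_sq_to_K] at hinner
  exact_mod_cast hinner

theorem norm_sum_smul_le_of_orthogonal {s : Finset ι} {e : ι → E} (he : ∀ i, ‖e i‖ ≤ 1)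
    (ho : (s : Set ι).Pairwise fun i j => ⟪e i, e j⟫_𝕜 = 0) (c : ι → 𝕜) :
    ‖∑ i ∈ s, c i • e i‖ ≤ √(∑ i ∈ s, ‖c i‖ ^ 2) := by
  apply Real.le_sqrt_of_sq_le
  rw [norm_sum_sq_of_orthogonal (𝕜 := 𝕜) fun i hi j hj hij => by
    simp only [inner_smul_left, inner_smul_right, ho hi hj hij, mul_zero]]
  gcongr with i
  rw [norm_smul]
  exact mul_le_of_le_one_right (norm_nonneg _) (he i)

variable (𝕜) in
theorem exists_orthonormal_sum_inner_mul_inner (t : Finset E) :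
    ∃ (n : ℕ) (e : Fin n → E), Orthonormal 𝕜 e ∧
      ∀ v ∈ t, ∀ w ∈ t, ∑ m, ⟪v, e m⟫_𝕜 * ⟪e m, w⟫_𝕜 = ⟪v, w⟫_𝕜 := by
  let W : Submodule 𝕜 E := Submodule.span 𝕜 t
  have : FiniteDimensional 𝕜 W := FiniteDimensional.span_finset 𝕜 t
  let b := stdOrthonormalBasis 𝕜 W
  refine ⟨_, fun m => b m, b.orthonormal.comp_linearIsometry W.subtypeₗᵢ, fun v hv w hw => ?_⟩
  exact b.sum_inner_mul_inner ⟨v, Submodule.subset_span hv⟩ ⟨w, Submodule.subset_span hw⟩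

/-- The vectors `x i` are mutually orthogonal and `x i` is the orthogonal projection of `ξ` to the
line through `x i`, as is the case for the components of `ξ` along orthogonal subspaces. -/
structure IsBlockFamily (𝕜 : Type*) {E ι : Type*} [RCLike 𝕜] [NormedAddCommGroup E]
    [InnerProductSpace 𝕜 E] (ξ : E) (x : ι → E) : Prop where
  orthogonal : Pairwise fun i j => ⟪x i, x j⟫_𝕜 = 0
  inner_left : ∀ i, ⟪x i, ξ⟫_𝕜 = (‖x i‖ ^ 2 : ℝ)

namespace IsBlockFamily

variable {ξ : E} {x : ι → E}

theorem norm_sum_sq (h : IsBlockFamily 𝕜 ξ x) (A : Finset ι) :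
    ‖∑ j ∈ A, x j‖ ^ 2 = ∑ j ∈ A, ‖x j‖ ^ 2 :=
  norm_sum_sq_of_orthogonal (h.orthogonal.set_pairwise _)

theorem norm_sub_sum_sq (h : IsBlockFamily 𝕜 ξ x) (A : Finset ι) :
    ‖ξ - ∑ j ∈ A, x j‖ ^ 2 = ‖ξ‖ ^ 2 - ∑ j ∈ A, ‖x j‖ ^ 2 := by
  have hcross : RCLike.re ⟪ξ, ∑ j ∈ A, x j⟫_𝕜 = ∑ j ∈ A, ‖x j‖ ^ 2 := by
    rw [inner_re_symm, sum_inner, Finset.sum_congr rfl fun j _ => h.inner_left j,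
      ← RCLike.ofReal_sum, RCLike.ofReal_re]
  rw [norm_sub_sq (𝕜 := 𝕜), hcross, h.norm_sum_sq]
  ring

theorem sqrt_sum_sq_le (h : IsBlockFamily 𝕜 ξ x) (A : Finset ι) :
    √(∑ j ∈ A, ‖x j‖ ^ 2) ≤ ‖ξ‖ :=
  Real.sqrt_le_iff.2 ⟨norm_nonneg ξ, by
    linarith [h.norm_sub_sum_sq A, sq_nonneg ‖ξ - ∑ j ∈ A, x j‖]⟩

theorem norm_sum_le (h : IsBlockFamily 𝕜 ξ x) (A : Finset ι) : ‖∑ j ∈ A, x j‖ ≤ ‖ξ‖ := by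
  rw [← Real.sqrt_sq (norm_nonneg (∑ j ∈ A, x j)), h.norm_sum_sq]
  exact h.sqrt_sum_sq_le A

theorem norm_le (h : IsBlockFamily 𝕜 ξ x) (i : ι) : ‖x i‖ ≤ ‖ξ‖ := by
  simpa only [Finset.sum_singleton] using h.norm_sum_le {i}

theorem sqrt_sum_sq_sdiff_le [DecidableEq ι] (h : IsBlockFamily 𝕜 ξ x) {A B : Finset ι}
    (hAB : A ⊆ B) : √(∑ j ∈ B \ A, ‖x j‖ ^ 2) ≤ ‖ξ - ∑ j ∈ A, x j‖ := by
  refine Real.sqrt_le_iff.2 ⟨norm_nonneg _, ?_⟩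
  linarith [h.norm_sub_sum_sq A, h.norm_sub_sum_sq B, sq_nonneg ‖ξ - ∑ j ∈ B, x j‖,
    Finset.sum_sdiff hAB (f := fun j => ‖x j‖ ^ 2)]

theorem norm_inner_sum_sub_le (hx : IsBlockFamily 𝕜 ξ x) {η : E} (T : E →L[𝕜] E) (y : ι → E)
    (A : Finset ι) :
    ‖⟪∑ i ∈ A, y i, T (∑ j ∈ A, x j)⟫_𝕜 - ⟪η, T ξ⟫_𝕜‖ ≤
      ‖T‖ * (‖ξ - ∑ j ∈ A, x j‖ * ‖η‖ + ‖ξ‖ * ‖η - ∑ i ∈ A, y i‖) := by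
  have hsplit : ⟪∑ i ∈ A, y i, T (∑ j ∈ A, x j)⟫_𝕜 - ⟪η, T ξ⟫_𝕜 =
      -(⟪η, T (ξ - ∑ j ∈ A, x j)⟫_𝕜 + ⟪η - ∑ i ∈ A, y i, T (∑ j ∈ A, x j)⟫_𝕜) := by
    simp only [map_sub, inner_sub_left, inner_sub_right]; ring
  rw [hsplit, norm_neg, mul_add]
  refine norm_add_le_of_le (norm_inner_apply_le T _ η) ((norm_inner_apply_le T _ _).trans ?_)
  gcongr
  exact hx.norm_sum_le A

end IsBlockFamily

end OrthogonalFamilies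

/-! ### Herz–Schur multipliers -/

section HerzSchur

variable {Λ E : Type*}

/-- The matrix `a`, restricted to the finite index set `s`, has operator norm at most `K`; it is
tested on pairs of vectors without a conjugate, as `ξ` and `η` range over all of `ℂ^s`. -/
def FormBound (s : Finset Λ) (a : Λ → Λ → ℂ) (K : ℝ) : Prop :=
  ∀ ξ η : Λ → ℂ, ‖∑ i ∈ s, ∑ j ∈ s, a i j * ξ j * η i‖ ≤
    K * (√(∑ j ∈ s, ‖ξ j‖ ^ 2) * √(∑ i ∈ s, ‖η i‖ ^ 2))

theorem FormBound.mono {s : Finset Λ} {a : Λ → Λ → ℂ} {K L : ℝ} (h : FormBound s a K)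
    (hKL : K ≤ L) : FormBound s a L := fun ξ η => (h ξ η).trans (by gcongr)

theorem formBound_map_iff {ι : Type*} {x : ι ↪ Λ} {s : Finset ι} {a : Λ → Λ → ℂ} {K : ℝ} :
    FormBound (s.map x) a K ↔ FormBound s (fun i j => a (x i) (x j)) K := by
  refine ⟨fun h ξ η => ?_, fun h ξ η => ?_⟩
  · simpa [x.injective.extend_apply] using h (Function.extend x ξ 0) (Function.extend x η 0)
  · simpa using h (ξ ∘ x) (η ∘ x)

variable [NormedAddCommGroup E] [InnerProductSpace ℂ E]

theorem FormBound.norm_sum_inner_le {s : Finset Λ} {a : Λ → Λ → ℂ} {K : ℝ} (hK : 0 ≤ K)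
    (h : FormBound s a K) (x y : Λ → E) :
    ‖∑ i ∈ s, ∑ j ∈ s, a i j * ⟪y i, x j⟫_ℂ‖ ≤
      K * (√(∑ j ∈ s, ‖x j‖ ^ 2) * √(∑ i ∈ s, ‖y i‖ ^ 2)) := by
  classical
  obtain ⟨n, e, -, he⟩ := exists_orthonormal_sum_inner_mul_inner ℂ (s.image x ∪ s.image y)
  have hxs : ∀ i ∈ s, x i ∈ s.image x ∪ s.image y := fun i hi =>
    Finset.mem_union_left _ (Finset.mem_image_of_mem x hi)
  have hys : ∀ i ∈ s, y i ∈ s.image x ∪ s.image y := fun i hi =>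
    Finset.mem_union_right _ (Finset.mem_image_of_mem y hi)
  have hparseval : ∀ v ∈ s.image x ∪ s.image y, ‖v‖ ^ 2 = ∑ m, ‖⟪e m, v⟫_ℂ‖ ^ 2 := fun v hv => by
    have hvv := he v hv v hv
    simp only [← inner_conj_symm v (e _), Complex.conj_mul', inner_self_eq_norm_sq_to_K] at hvv
    apply Complex.ofReal_injective
    push_cast
    exact hvv.symm
  have hsum : ∑ i ∈ s, ∑ j ∈ s, a i j * ⟪y i, x j⟫_ℂ =
      ∑ m, ∑ i ∈ s, ∑ j ∈ s, a i j * ⟪e m, x j⟫_ℂ * ⟪y i, e m⟫_ℂ := by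
    rw [Finset.sum_comm (s := Finset.univ)]
    refine Finset.sum_congr rfl fun i hi => ?_
    rw [Finset.sum_comm (s := Finset.univ)]
    refine Finset.sum_congr rfl fun j hj => ?_
    rw [← he _ (hys i hi) _ (hxs j hj), Finset.mul_sum]
    exact Finset.sum_congr rfl fun m _ => by ring
  calc _ ≤ ∑ m, K * (√(∑ j ∈ s, ‖⟪e m, x j⟫_ℂ‖ ^ 2) * √(∑ i ∈ s, ‖⟪y i, e m⟫_ℂ‖ ^ 2)) :=
        hsum ▸ norm_sum_le_of_le _ fun m _ => h _ _
    _ ≤ K * (√(∑ m, ∑ j ∈ s, ‖⟪e m, x j⟫_ℂ‖ ^ 2) * √(∑ m, ∑ i ∈ s, ‖⟪y i, e m⟫_ℂ‖ ^ 2)) := by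
        rw [← Finset.mul_sum]
        gcongr
        exact Real.sum_sqrt_mul_sqrt_le _ (fun _ => by positivity) (fun _ => by positivity)
    _ = _ := by
        rw [Finset.sum_comm, Finset.sum_comm (s := Finset.univ)]
        simp only [norm_inner_symm (y _) (e _)]
        rw [Finset.sum_congr rfl fun j hj => hparseval _ (hxs j hj),
          Finset.sum_congr rfl fun i hi => hparseval _ (hys i hi)]

theorem formBound_inner_of_orthogonal (T : E →L[ℂ] E) {s : Finset Λ} {e f : Λ → E}
    (he : ∀ i, ‖e i‖ ≤ 1) (hf : ∀ i, ‖f i‖ ≤ 1)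
    (hoe : (s : Set Λ).Pairwise fun i j => ⟪e i, e j⟫_ℂ = 0)
    (hof : (s : Set Λ).Pairwise fun i j => ⟪f i, f j⟫_ℂ = 0) :
    FormBound s (fun i j => ⟪f i, T (e j)⟫_ℂ) ‖T‖ := by
  intro ξ η
  have hform : ∑ i ∈ s, ∑ j ∈ s, ⟪f i, T (e j)⟫_ℂ * ξ j * η i =
      ⟪∑ i ∈ s, (starRingEnd ℂ) (η i) • f i, T (∑ j ∈ s, ξ j • e j)⟫_ℂ := by
    rw [map_sum, sum_inner]
    refine Finset.sum_congr rfl fun i _ => ?_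
    rw [inner_sum]
    refine Finset.sum_congr rfl fun j _ => ?_
    rw [map_smul, inner_smul_left, inner_smul_right, Complex.conj_conj]
    ring
  rw [hform]
  refine (norm_inner_apply_le T _ _).trans ?_
  gcongr
  · exact norm_sum_smul_le_of_orthogonal he hoe ξ
  · simpa only [RCLike.norm_conj] using
      norm_sum_smul_le_of_orthogonal hf hof fun i => starRingEnd ℂ (η i)

theorem FormBound.const_mul {s : Finset Λ} {a : Λ → Λ → ℂ} {K : ℝ} (h : FormBound s a K) (c : ℂ) :
    FormBound s (fun i j => c * a i j) (‖c‖ * K) := by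
  intro ξ η
  simp only [mul_assoc c, ← Finset.mul_sum, norm_mul c, mul_assoc ‖c‖]
  exact mul_le_mul_of_nonneg_left (h ξ η) (norm_nonneg c)

theorem norm_sum_mul_inner_sub_inner_sum_le {ξ η : E} {x y : Λ → E}
    (T : E →L[ℂ] E) (hx : IsBlockFamily ℂ ξ x)
    (hy : IsBlockFamily ℂ η y) {A : Finset Λ} {a : Λ → Λ → ℂ} {δ : ℝ}
    (hδ : ∀ i ∈ A, ∀ j ∈ A, ‖a i j - 1‖ ≤ δ) :
    ‖∑ i ∈ A, ∑ j ∈ A, a i j * ⟪y i, T (x j)⟫_ℂ - ⟪∑ i ∈ A, y i, T (∑ j ∈ A, x j)⟫_ℂ‖ ≤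
      ‖T‖ * ((A.card : ℝ) ^ 2 * δ * (‖ξ‖ * ‖η‖)) := by
  have hdiff : ∑ i ∈ A, ∑ j ∈ A, a i j * ⟪y i, T (x j)⟫_ℂ -
      ⟪∑ i ∈ A, y i, T (∑ j ∈ A, x j)⟫_ℂ = ∑ i ∈ A, ∑ j ∈ A, (a i j - 1) * ⟪y i, T (x j)⟫_ℂ := by
    rw [map_sum, sum_inner, ← Finset.sum_sub_distrib]
    simp only [inner_sum, ← Finset.sum_sub_distrib, sub_one_mul]
  rw [hdiff]
  calc _ ≤ ∑ _i ∈ A, ∑ _j ∈ A, δ * (‖T‖ * (‖ξ‖ * ‖η‖)) := by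
        refine norm_sum_le_of_le _ fun i hi => norm_sum_le_of_le _ fun j hj => ?_
        refine norm_mul_le_of_le (hδ i hi j hj) ((norm_inner_apply_le T _ _).trans ?_)
        gcongr
        exacts [hx.norm_le j, hy.norm_le i]
    _ = _ := by simp only [Finset.sum_const, nsmul_eq_mul]; ring

variable [Group Λ]

theorem sum_support_eq_sum_rect {φ : Λ → ℂ} {F A s : Finset Λ}
    (hF : ∀ i, φ i ≠ 0 → i ∈ F) (hs : ∀ σ ∈ F, ∀ j ∈ A, σ * j ∈ s) (B : Λ → Λ → ℂ) :
    ∑ j ∈ A, ∑ σ ∈ F, φ σ * B (σ * j) j = ∑ i ∈ s, ∑ j ∈ A, φ (i * j⁻¹) * B i j := by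
  classical
  rw [Finset.sum_comm (s := s)]
  refine Finset.sum_congr rfl fun j hj => ?_
  refine Finset.sum_bij_ne_zero (fun σ _ _ => σ * j) (fun σ hσ _ => hs σ hσ j hj)
    (fun _ _ _ _ _ _ h => mul_right_cancel h) (fun i _ hi => ?_) (fun σ _ _ => by simp)
  exact ⟨i * j⁻¹, hF _ (left_ne_zero_of_mul hi), by simpa using hi, by simp⟩

/-- Every finite section of `(φ(i j⁻¹))` is a Schur multiplier of norm at most `K`, that is, `φ`
is a Herz–Schur multiplier of norm at most `K` of the group `Λ` regarded as discrete. -/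
def HerzSchurBound (φ : Λ → ℂ) (K : ℝ) : Prop :=
  ∀ (s : Finset Λ) (a : Λ → Λ → ℂ), FormBound s a 1 →
    FormBound s (fun i j => φ (i * j⁻¹) * a i j) K

namespace HerzSchurBound

variable {φ ψ : Λ → ℂ} {k l : ℝ}

theorem formBound_mul (h : HerzSchurBound φ k) {s : Finset Λ} {a : Λ → Λ → ℂ} {K : ℝ}
    (hK : 0 < K) (ha : FormBound s a K) : FormBound s (fun i j => φ (i * j⁻¹) * a i j) (k * K) := by
  have hK' : ‖(K : ℂ)‖ = K := RCLike.norm_of_nonneg hK.le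
  have hunit : FormBound s (fun i j => (K : ℂ)⁻¹ * a i j) 1 := by
    simpa only [norm_inv, hK', inv_mul_cancel₀ hK.ne'] using ha.const_mul (K : ℂ)⁻¹
  have hK0 : (K : ℂ) ≠ 0 := Complex.ofReal_ne_zero.2 hK.ne'
  simpa only [mul_left_comm (K : ℂ), inv_mul_cancel_left₀ hK0, hK', mul_comm K k] using
    (h s _ hunit).const_mul (K : ℂ)

theorem norm_sum_inner_le (h : HerzSchurBound φ k) (T : E →L[ℂ] E) (s : Finset Λ) {x y : Λ → E}
    (hx : (s : Set Λ).Pairwise fun i j => ⟪x i, x j⟫_ℂ = 0)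
    (hy : (s : Set Λ).Pairwise fun i j => ⟪y i, y j⟫_ℂ = 0) :
    ‖∑ i ∈ s, ∑ j ∈ s, φ (i * j⁻¹) * ⟪y i, T (x j)⟫_ℂ‖ ≤
      k * ‖T‖ * (√(∑ j ∈ s, ‖x j‖ ^ 2) * √(∑ i ∈ s, ‖y i‖ ^ 2)) := by
  rcases eq_or_ne T 0 with rfl | hT
  · simp
  let unit : E → E := fun v => ((‖v‖⁻¹ : ℝ) : ℂ) • v
  have hunit : ∀ v, ‖unit v‖ ≤ 1 := fun v => by
    simpa only [unit, norm_smul, Complex.norm_real, norm_inv, norm_norm] using inv_mul_le_one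
  have hsmul : ∀ v, (‖v‖ : ℂ) • unit v = v := fun v => by
    rcases eq_or_ne v 0 with rfl | hv
    · simp [unit]
    · simp [unit, smul_smul, hv]
  have hinner : ∀ v w : E, ⟪v, w⟫_ℂ = 0 → ⟪unit v, unit w⟫_ℂ = 0 := fun v w hvw => by
    simp [unit, hvw]
  have hform := formBound_inner_of_orthogonal T (fun i => hunit (x i)) (fun i => hunit (y i))
    (fun i hi j hj hij => hinner _ _ (hx hi hj hij))
    (fun i hi j hj hij => hinner _ _ (hy hi hj hij))
  have hbound := h.formBound_mul (norm_pos_iff.2 hT) hform (fun j => ‖x j‖) (fun i => ‖y i‖)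
  simp only [Complex.norm_real, norm_norm] at hbound
  have hscale : ∀ v w, ⟪w, T v⟫_ℂ = ⟪unit w, T (unit v)⟫_ℂ * ‖v‖ * ‖w‖ := fun v w => by
    conv_lhs => rw [← hsmul v, ← hsmul w, map_smul, inner_smul_left, inner_smul_right,
      Complex.conj_ofReal]
    ring
  rw [Finset.sum_congr rfl fun i _ => Finset.sum_congr rfl fun j _ => by
    rw [hscale (x j) (y i), ← mul_assoc, ← mul_assoc]]
  exact hbound

theorem norm_sum_rect_inner_le (h : HerzSchurBound φ k) (T : E →L[ℂ] E) {A B : Finset Λ}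
    {x y : Λ → E} (hx : (A : Set Λ).Pairwise fun i j => ⟪x i, x j⟫_ℂ = 0)
    (hy : (B : Set Λ).Pairwise fun i j => ⟪y i, y j⟫_ℂ = 0) :
    ‖∑ i ∈ B, ∑ j ∈ A, φ (i * j⁻¹) * ⟪y i, T (x j)⟫_ℂ‖ ≤
      k * ‖T‖ * (√(∑ j ∈ A, ‖x j‖ ^ 2) * √(∑ i ∈ B, ‖y i‖ ^ 2)) := by
  classical
  have hsquare := h.norm_sum_inner_le T (A ∪ B) (x := fun j => if j ∈ A then x j else 0)
    (y := fun i => if i ∈ B then y i else 0)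
    (fun i _ j _ hij => by
      by_cases hi : i ∈ A <;> by_cases hj : j ∈ A <;>
        simp only [hi, hj, if_true, if_false, inner_zero_left, inner_zero_right]
      exact hx hi hj hij)
    (fun i _ j _ hij => by
      by_cases hi : i ∈ B <;> by_cases hj : j ∈ B <;>
        simp only [hi, hj, if_true, if_false, inner_zero_left, inner_zero_right]
      exact hy hi hj hij)
  have hzero : ∀ (p : Prop) [Decidable p] (v w : E),
      ⟪if p then v else 0, w⟫_ℂ = if p then ⟪v, w⟫_ℂ else 0 := fun p _ v w => by
    split_ifs <;> simp
  simpa [hzero, Finset.sum_ite, apply_ite, ite_pow, ← Finset.sum_filter,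
    Finset.filter_mem_eq_inter, Finset.inter_eq_right.2 Finset.subset_union_left,
    Finset.inter_eq_right.2 Finset.subset_union_right] using hsquare

theorem norm_le (h : HerzSchurBound φ k) (x : Λ) : ‖φ x‖ ≤ k := by
  simpa using h.norm_sum_rect_inner_le (1 : ℂ →L[ℂ] ℂ) (A := {1}) (B := {x}) (x := 1) (y := 1)
    (by simp) (by simp)

theorem add (hφ : HerzSchurBound φ k) (hψ : HerzSchurBound ψ l) :
    HerzSchurBound (φ + ψ) (k + l) := by
  intro s a ha ξ η
  simp only [Pi.add_apply, add_mul, Finset.sum_add_distrib]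
  exact norm_add_le_of_le (hφ s a ha ξ η) (hψ s a ha ξ η)

theorem const_mul (hφ : HerzSchurBound φ k) (c : ℂ) :
    HerzSchurBound (fun x => c * φ x) (‖c‖ * k) := by
  intro s a ha
  simpa only [mul_assoc] using (hφ s a ha).const_mul c

theorem comp_injective {Λ' : Type*} [Group Λ'] (hφ : HerzSchurBound φ k) {j : Λ' →* Λ}
    (hj : Function.Injective j) : HerzSchurBound (φ ∘ j) k := by
  intro s a ha
  let j' : Λ' ↪ Λ := ⟨j, hj⟩
  let i := Function.invFun j
  have hi : ∀ x, i (j x) = x := Function.leftInverse_invFun hj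
  have hform := hφ (s.map j') (fun x y => a (i x) (i y))
    (formBound_map_iff.2 (by simpa [j', hi] using ha))
  simpa [j', hi] using formBound_map_iff.1 hform

theorem of_hasSum {ι : Type*} {φ' : ι → Λ → ℂ}
    {k' : ι → ℝ} (hφ : ∀ x, HasSum (fun n => φ' n x) (φ x)) (hK : HasSum k' k)
    (h : ∀ n, HerzSchurBound (φ' n) (k' n)) : HerzSchurBound φ k := by
  intro s a ha ξ η
  have hform : HasSum (fun n => ∑ i ∈ s, ∑ j ∈ s, φ' n (i * j⁻¹) * a i j * ξ j * η i)
      (∑ i ∈ s, ∑ j ∈ s, φ (i * j⁻¹) * a i j * ξ j * η i) :=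
    hasSum_sum fun i _ => hasSum_sum fun j _ =>
      (((hφ (i * j⁻¹)).mul_right (a i j)).mul_right (ξ j)).mul_right (η i)
  exact hform.norm_le_of_bounded (hK.mul_right _) fun n => h n s a ha ξ η

theorem of_forall_pos_add (h : ∀ ε > 0, HerzSchurBound φ (k + ε)) : HerzSchurBound φ k := by
  intro s a ha ξ η
  have hlim : Tendsto (fun ε => (k + ε) * (√(∑ j ∈ s, ‖ξ j‖ ^ 2) * √(∑ i ∈ s, ‖η i‖ ^ 2)))
      (𝓝[>] 0) (𝓝 (k * (√(∑ j ∈ s, ‖ξ j‖ ^ 2) * √(∑ i ∈ s, ‖η i‖ ^ 2)))) :=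
    (Continuous.tendsto' (by fun_prop) 0 _ (by simp)).mono_left nhdsWithin_le_nhds
  exact ge_of_tendsto hlim (eventually_mem_nhdsWithin.mono fun ε hε => h ε hε s a ha ξ η)

variable {ξ η : E} {x y : Λ → E}

theorem norm_sum_support_le (h : HerzSchurBound φ k) (hk : 0 ≤ k) (T : E →L[ℂ] E)
    (hx : IsBlockFamily ℂ ξ x) (hy : IsBlockFamily ℂ η y) {F : Finset Λ}
    (hF : ∀ i, φ i ≠ 0 → i ∈ F) (A : Finset Λ) :
    ‖∑ j ∈ A, ∑ σ ∈ F, φ σ * ⟪y (σ * j), T (x j)⟫_ℂ‖ ≤ k * ‖T‖ * (‖ξ‖ * ‖η‖) := by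
  classical
  rw [sum_support_eq_sum_rect hF (s := Finset.image₂ (· * ·) F A)
    (fun σ hσ j hj => Finset.mem_image₂_of_mem hσ hj) (fun i j => ⟪y i, T (x j)⟫_ℂ)]
  refine (h.norm_sum_rect_inner_le T (hx.orthogonal.set_pairwise _)
    (hy.orthogonal.set_pairwise _)).trans ?_
  gcongr
  exacts [hx.sqrt_sum_sq_le A, hy.sqrt_sum_sq_le _]

theorem norm_sum_rect_sub_sum_square_le (h : HerzSchurBound φ k) (hk : 0 ≤ k)
    (T : E →L[ℂ] E) (hx : IsBlockFamily ℂ ξ x) (hy : IsBlockFamily ℂ η y) {A B C : Finset Λ}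
    (hAB : A ⊆ B) (hAC : A ⊆ C) :
    ‖∑ i ∈ C, ∑ j ∈ B, φ (i * j⁻¹) * ⟪y i, T (x j)⟫_ℂ -
        ∑ i ∈ A, ∑ j ∈ A, φ (i * j⁻¹) * ⟪y i, T (x j)⟫_ℂ‖ ≤
      k * ‖T‖ * (‖ξ - ∑ j ∈ A, x j‖ * ‖η‖ + ‖ξ‖ * ‖η - ∑ j ∈ A, y j‖) := by
  classical
  set a : Λ → Λ → ℂ := fun i j => φ (i * j⁻¹) * ⟪y i, T (x j)⟫_ℂ
  have hrect : ∀ A B : Finset Λ, ‖∑ i ∈ B, ∑ j ∈ A, a i j‖ ≤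
      k * ‖T‖ * (√(∑ j ∈ A, ‖x j‖ ^ 2) * √(∑ i ∈ B, ‖y i‖ ^ 2)) := fun A B =>
    h.norm_sum_rect_inner_le T (hx.orthogonal.set_pairwise _) (hy.orthogonal.set_pairwise _)
  have hsplit : ∑ i ∈ C, ∑ j ∈ B, a i j - ∑ i ∈ A, ∑ j ∈ A, a i j =
      ∑ i ∈ C, ∑ j ∈ B \ A, a i j + ∑ i ∈ C \ A, ∑ j ∈ A, a i j := by
    simp only [← Finset.sum_sdiff hAB, Finset.sum_add_distrib]
    rw [← Finset.sum_sdiff hAC (f := fun i => ∑ j ∈ A, a i j)]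
    ring
  rw [hsplit, mul_add]
  refine norm_add_le_of_le ((hrect _ _).trans ?_) ((hrect _ _).trans ?_) <;> gcongr
  exacts [hx.sqrt_sum_sq_sdiff_le hAB, hy.sqrt_sum_sq_le C, hx.sqrt_sum_sq_le A,
    hy.sqrt_sum_sq_sdiff_le hAC]

theorem norm_sum_support_sub_le (h : HerzSchurBound φ k) (hk : 0 ≤ k) (T : E →L[ℂ] E)
    (hx : IsBlockFamily ℂ ξ x) (hy : IsBlockFamily ℂ η y) {F : Finset Λ}
    (hF : ∀ i, φ i ≠ 0 → i ∈ F) {A B : Finset Λ} (hAB : A ⊆ B) {δ : ℝ}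
    (hδ : ∀ i ∈ A, ∀ j ∈ A, ‖φ (i * j⁻¹) - 1‖ ≤ δ) :
    ‖∑ j ∈ B, ∑ σ ∈ F, φ σ * ⟪y (σ * j), T (x j)⟫_ℂ - ⟪η, T ξ⟫_ℂ‖ ≤
      ‖T‖ * ((k + 1) * (‖ξ - ∑ j ∈ A, x j‖ * ‖η‖ + ‖ξ‖ * ‖η - ∑ j ∈ A, y j‖) +
        (A.card : ℝ) ^ 2 * δ * (‖ξ‖ * ‖η‖)) := by
  classical
  have hFB : ∀ σ ∈ F, ∀ j ∈ B, σ * j ∈ A ∪ Finset.image₂ (· * ·) F B := fun σ hσ j hj =>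
    Finset.mem_union_right _ (Finset.mem_image₂_of_mem hσ hj)
  rw [sum_support_eq_sum_rect hF hFB fun i j => ⟪y i, T (x j)⟫_ℂ]
  have htail := h.norm_sum_rect_sub_sum_square_le hk T hx hy hAB Finset.subset_union_left
    (C := A ∪ Finset.image₂ (· * ·) F B)
  have hsquare := norm_sum_mul_inner_sub_inner_sum_le T hx hy hδ
  have hcut := hx.norm_inner_sum_sub_le (η := η) T y A
  refine ((norm_sub_le_norm_sub_add_norm_sub _ _ _).trans (add_le_add htail
    ((norm_sub_le_norm_sub_add_norm_sub _ _ _).trans (add_le_add hsquare hcut)))).trans_eq ?_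
  ring

end HerzSchurBound

/-- Approximation of `1` by finitely supported functions with Herz–Schur norms at most `k`; the
least such `k` is the Cowling–Haagerup constant of the discrete group `Λ`. -/
def HasFiniteHerzSchurApproximation (Λ : Type*) [Group Λ] (k : ℝ) : Prop :=
  ∀ (F : Finset Λ) (ε : ℝ), 0 < ε → ∃ ψ : Λ → ℂ, (Function.support ψ).Finite ∧
    HerzSchurBound ψ k ∧ ∀ x ∈ F, ‖ψ x - 1‖ < ε

theorem HasFiniteHerzSchurApproximation.congr {Λ' : Type*} [Group Λ'] {k : ℝ}
    (h : HasFiniteHerzSchurApproximation Λ k) (e : Λ' ≃* Λ) :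
    HasFiniteHerzSchurApproximation Λ' k := by
  classical
  intro F ε hε
  obtain ⟨ψ, hfin, hψ, hF⟩ := h (F.image e) ε hε
  exact ⟨ψ ∘ e, hfin.preimage e.injective.injOn, hψ.comp_injective (j := e.toMonoidHom) e.injective,
    fun x hx => hF _ (Finset.mem_image_of_mem _ hx)⟩

end HerzSchur

/-! ### The group von Neumann algebra and its normal functionals -/

section DiagonalOperators

theorem hasSum_norm_sq_lp {ι H : Type*} [NormedAddCommGroup H] (f : ℓ²(ι, H)) :
    HasSum (fun i => ‖f i‖ ^ 2) (‖f‖ ^ 2) := by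
  simpa using lp.hasSum_norm (p := 2) (by simp) f

theorem memℓp_two_of_summable {ι H : Type*} [NormedAddCommGroup H] {f : ι → H}
    (hf : Summable fun i => ‖f i‖ ^ 2) : Memℓp (E := fun _ : ι => H) f 2 :=
  memℓp_gen (by simpa using hf)

variable {ι H : Type*} [NormedAddCommGroup H] [InnerProductSpace ℂ H]

/-- The amplification `T ⊕ T ⊕ ⋯` of `T` to a Hilbert sum of copies of `H`. -/
def diagOp (ι : Type*) (T : H →L[ℂ] H) : ℓ²(ι, H) →L[ℂ] ℓ²(ι, H) :=
  lp.mapCLM 2 (fun _ => T) (norm_nonneg T) fun _ => le_rfl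

@[simp]
theorem diagOp_apply (T : H →L[ℂ] H) (f : ℓ²(ι, H)) (i : ι) : diagOp ι T f i = T (f i) :=
  rfl

theorem norm_diagOp_le (T : H →L[ℂ] H) : ‖diagOp ι T‖ ≤ ‖T‖ :=
  lp.norm_mapCLM_le ..

theorem diagOp_single [DecidableEq ι] (T : H →L[ℂ] H) (i : ι) (h : H) :
    diagOp ι T (lp.single 2 i h) = lp.single 2 i (T h) := by
  ext j
  rcases eq_or_ne j i with rfl | hj
  · simp
  · simp [hj]

theorem commute_diagOp_of_mem_bicommutant {𝒮 : Set (H →L[ℂ] H)}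
    {P : ℓ²(ι, H) →L[ℂ] ℓ²(ι, H)} (hP : ∀ A ∈ 𝒮, Commute P (diagOp ι A)) {T : H →L[ℂ] H}
    (hT : T ∈ Set.centralizer (Set.centralizer 𝒮)) : Commute P (diagOp ι T) := by
  classical
  let entry (m n : ι) : H →L[ℂ] H :=
    lp.evalCLM ℂ (fun _ : ι => H) 2 m ∘L P ∘L lp.singleContinuousLinearMap ℂ (fun _ : ι => H) 2 n
  have happly : ∀ m n h, entry m n h = P (lp.single 2 n h) m := fun _ _ _ => rfl
  have hentry : ∀ m n, entry m n ∈ Set.centralizer 𝒮 := fun m n A hA => by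
    ext h
    have hcomm := congr_arg (fun F => F m) (DFunLike.congr_fun (hP A hA) (lp.single 2 n h))
    simpa [happly, diagOp_single] using hcomm.symm
  refine lp.ext_continuousLinearMap (by simp) fun n => ContinuousLinearMap.ext fun h => ?_
  ext m
  simpa [happly, diagOp_single] using DFunLike.congr_fun (hT _ (hentry m n)) h

variable [CompleteSpace H]

theorem adjoint_diagOp (T : H →L[ℂ] H) : (diagOp ι T).adjoint = diagOp ι T.adjoint := by
  refine ((ContinuousLinearMap.eq_adjoint_iff _ _).2 fun f g => ?_).symm
  simp only [lp.inner_eq_tsum, diagOp_apply, ContinuousLinearMap.adjoint_inner_left]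

theorem diagOp_mem_closure_span_of_mem_bicommutant {𝒮 : Submonoid (H →L[ℂ] H)}
    (hstar : ∀ A ∈ 𝒮, star A ∈ 𝒮) {T : H →L[ℂ] H}
    (hT : T ∈ Set.centralizer (Set.centralizer (𝒮 : Set (H →L[ℂ] H)))) (f : ℓ²(ι, H)) :
    diagOp ι T f ∈ (Submodule.span ℂ ((diagOp ι · f) '' 𝒮)).topologicalClosure := by
  set N := Submodule.span ℂ ((diagOp ι · f) '' (𝒮 : Set (H →L[ℂ] H)))
  have : CompleteSpace N.topologicalClosure := N.isClosed_topologicalClosure.completeSpace_coe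
  have hinvariant : ∀ B ∈ 𝒮, N.topologicalClosure ∈
      Module.End.invtSubmodule (diagOp ι B).toLinearMap := fun B hB v hv => by
    have hN : N ≤ N.comap (diagOp ι B).toLinearMap := by
      refine Submodule.span_le.2 ?_
      rintro _ ⟨A, hA, rfl⟩
      exact Submodule.subset_span ⟨B * A, 𝒮.mul_mem hB hA, rfl⟩
    exact map_mem_closure (diagOp ι B).continuous hv hN
  have hproj : Commute N.topologicalClosure.starProjection (diagOp ι T) := by
    refine commute_diagOp_of_mem_bicommutant (fun B hB => ?_) hT
    rw [ContinuousLinearMap.IsIdempotentElem.commute_iff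
        (Submodule.isIdempotentElem_starProjection _),
      Submodule.range_starProjection, Submodule.ker_starProjection]
    refine ⟨hinvariant B hB, ContinuousLinearMap.orthogonal_mem_invtSubmodule ?_⟩
    rw [adjoint_diagOp]
    exact hinvariant _ (hstar B hB)
  have hf : f ∈ N.topologicalClosure :=
    N.le_topologicalClosure (Submodule.subset_span ⟨1, 𝒮.one_mem, rfl⟩)
  have hTf := DFunLike.congr_fun hproj f
  rw [mul_apply_eq_comp, mul_apply_eq_comp, Submodule.starProjection_eq_self_iff.2 hf] at hTf
  exact Submodule.starProjection_eq_self_iff.1 hTf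

theorem inner_diagOp_eq_zero_of_mem_bicommutant {𝒮 : Submonoid (H →L[ℂ] H)}
    (hstar : ∀ A ∈ 𝒮, star A ∈ 𝒮) {T : H →L[ℂ] H}
    (hT : T ∈ Set.centralizer (Set.centralizer (𝒮 : Set (H →L[ℂ] H)))) {f g : ℓ²(ι, H)}
    (h0 : ∀ A ∈ 𝒮, ⟪g, diagOp ι A f⟫_ℂ = 0) : ⟪g, diagOp ι T f⟫_ℂ = 0 := by
  have hspan : Submodule.span ℂ ((diagOp ι · f) '' (𝒮 : Set (H →L[ℂ] H))) ≤ (ℂ ∙ g)ᗮ := by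
    refine Submodule.span_le.2 ?_
    rintro _ ⟨A, hA, rfl⟩
    exact Submodule.mem_orthogonal_singleton_iff_inner_right.2 (h0 A hA)
  exact Submodule.mem_orthogonal_singleton_iff_inner_right.1 <|
    Submodule.topologicalClosure_minimal _ hspan (Submodule.isClosed_orthogonal _)
      (diagOp_mem_closure_span_of_mem_bicommutant hstar hT f)

end DiagonalOperators

section LeftRegular

variable {G : Type u} [Group G] [MeasurableSpace G] [MeasurableMul G]
  (μ : Measure G) [μ.IsMulLeftInvariant]

theorem coeFn_leftRegular (x : G) (f : Lp ℂ 2 μ) :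
    leftRegular μ x f =ᵐ[μ] fun y => f (x⁻¹ * y) :=
  Lp.coeFn_compMeasurePreserving f (measurePreserving_mul_left μ x⁻¹)

theorem leftRegular_mul (x y : G) : leftRegular μ (x * y) = leftRegular μ x * leftRegular μ y := by
  ext1 f
  change Lp.compMeasurePreserving _ _ f =
    Lp.compMeasurePreserving _ _ (Lp.compMeasurePreserving _ _ f)
  rw [← Lp.compMeasurePreserving_comp_apply]
  congr 2
  funext z
  simp [mul_assoc]

theorem leftRegular_one : leftRegular μ (1 : G) = 1 := by
  refine ContinuousLinearMap.ext fun f => Lp.ext ?_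
  filter_upwards [coeFn_leftRegular μ 1 f] with y hy
  simpa using hy

theorem norm_leftRegular_apply (x : G) (f : Lp ℂ 2 μ) : ‖leftRegular μ x f‖ = ‖f‖ :=
  LinearIsometry.norm_map _ f

theorem inner_leftRegular_leftRegular (x : G) (f g : Lp ℂ 2 μ) :
    ⟪leftRegular μ x f, leftRegular μ x g⟫_ℂ = ⟪f, g⟫_ℂ :=
  LinearIsometry.inner_map_map (Lp.compMeasurePreservingₗᵢ ℂ (fun y => x⁻¹ * y)
    (measurePreserving_mul_left μ x⁻¹)) f g

theorem inner_leftRegular_right (x : G) (f g : Lp ℂ 2 μ) :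
    ⟪f, leftRegular μ x g⟫_ℂ = ⟪leftRegular μ x⁻¹ f, g⟫_ℂ := by
  rw [← inner_leftRegular_leftRegular μ x (leftRegular μ x⁻¹ f) g, ← mul_apply_eq_comp,
    ← leftRegular_mul, mul_inv_cancel, leftRegular_one, one_apply_eq_self]

theorem star_leftRegular (x : G) : star (leftRegular μ x) = leftRegular μ x⁻¹ :=
  ((ContinuousLinearMap.eq_adjoint_iff _ _).2 fun f g =>
    (inner_leftRegular_right μ x f g).symm).symm

theorem mem_groupVN_iff_mem_bicommutant {T : Lp ℂ 2 μ →L[ℂ] Lp ℂ 2 μ} :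
    T ∈ (groupVN μ).toStarSubalgebra ↔
      T ∈ Set.centralizer (Set.centralizer (Set.range (leftRegular μ))) := by
  have hstar : star (Set.range (leftRegular μ)) ⊆ Set.range (leftRegular μ) := by
    rintro A ⟨x, hx⟩
    exact ⟨x⁻¹, by rw [← star_leftRegular, hx, star_star]⟩
  change T ∈ StarSubalgebra.centralizer ℂ
    (StarSubalgebra.centralizer ℂ (Set.range (leftRegular μ)) :
      Set (Lp ℂ 2 μ →L[ℂ] Lp ℂ 2 μ)) ↔ _
  rw [← SetLike.mem_coe, StarSubalgebra.coe_centralizer_centralizer, Set.union_eq_left.2 hstar]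

end LeftRegular

section NormalFunctionals

variable {G : Type u} [Group G] [MeasurableSpace G] [MeasurableMul G]
  {μ : Measure G} [μ.IsMulLeftInvariant]

namespace IsNormalFunctional

variable {ω ω' : GroupVN μ →L[ℂ] ℂ}

theorem of_countable {ι : Type*} [Countable ι] {f g : ι → Lp ℂ 2 μ}
    (hf : Summable fun i => ‖f i‖ ^ 2) (hg : Summable fun i => ‖g i‖ ^ 2)
    (h : ∀ T : GroupVN μ, HasSum (fun i => ⟪g i, T.1 (f i)⟫_ℂ) (ω T)) :
    IsNormalFunctional ω := by
  obtain ⟨e, he⟩ := Countable.exists_injective_nat ι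
  have hextend : ∀ {M : Type} [AddCommMonoid M] (F : Lp ℂ 2 μ → Lp ℂ 2 μ → M), F 0 0 = 0 →
      Function.extend e (fun i => F (f i) (g i)) 0 =
        fun n => F (Function.extend e f 0 n) (Function.extend e g 0 n) := fun F hF => by
    funext n
    by_cases hn : ∃ i, e i = n
    · obtain ⟨i, rfl⟩ := hn
      simp only [he.extend_apply]
    · simp only [Function.extend_apply' _ _ _ hn, Pi.zero_apply, hF]
  refine ⟨Function.extend e f 0, Function.extend e g 0, ?_, ?_, fun T => ?_⟩
  · exact hextend (fun u _ => ‖u‖ ^ 2) (by simp) ▸ ((hasSum_extend_zero he).2 hf.hasSum).summable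
  · exact hextend (fun _ v => ‖v‖ ^ 2) (by simp) ▸ ((hasSum_extend_zero he).2 hg.hasSum).summable
  · exact hextend (fun u v => ⟪v, T.1 u⟫_ℂ) (by simp) ▸ (hasSum_extend_zero he).2 (h T)

theorem add (h : IsNormalFunctional ω) (h' : IsNormalFunctional ω') :
    IsNormalFunctional (ω + ω') := by
  obtain ⟨f, g, hf, hg, hω⟩ := h
  obtain ⟨f', g', hf', hg', hω'⟩ := h'
  exact of_countable (f := Sum.elim f f') (g := Sum.elim g g')
    (HasSum.sum (f := fun i => ‖Sum.elim f f' i‖ ^ 2) hf.hasSum hf'.hasSum).summable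
    (HasSum.sum (f := fun i => ‖Sum.elim g g' i‖ ^ 2) hg.hasSum hg'.hasSum).summable
    fun T => HasSum.sum (hω T) (hω' T)

theorem smul (h : IsNormalFunctional ω) (c : ℂ) : IsNormalFunctional (c • ω) := by
  obtain ⟨f, g, hf, hg, hω⟩ := h
  refine ⟨fun n => c • f n, g, ?_, hg, fun T => ?_⟩
  · simpa only [norm_smul, mul_pow] using hf.mul_left (‖c‖ ^ 2)
  · simp only [map_smul, inner_smul_right]
    exact (hω T).mul_left c

theorem zero : IsNormalFunctional (0 : GroupVN μ →L[ℂ] ℂ) :=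
  ⟨0, 0, by simp, by simp, fun T => by simp⟩

theorem sub (h : IsNormalFunctional ω) (h' : IsNormalFunctional ω') :
    IsNormalFunctional (ω - ω') := by
  rw [sub_eq_add_neg, ← neg_one_smul ℂ ω']
  exact h.add (h'.smul (-1))

theorem eq_zero (h : IsNormalFunctional ω) (h0 : ∀ x, ω (leftRegularVN μ x) = 0) : ω = 0 := by
  obtain ⟨f, g, hf, hg, hω⟩ := h
  let f' : ℓ²(ℕ, Lp ℂ 2 μ) := ⟨f, memℓp_two_of_summable hf⟩
  let g' : ℓ²(ℕ, Lp ℂ 2 μ) := ⟨g, memℓp_two_of_summable hg⟩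
  have hinner : ∀ T : GroupVN μ, ω T = ⟪g', diagOp ℕ T.1 f'⟫_ℂ := fun T => by
    rw [lp.inner_eq_tsum]
    exact (hω T).tsum_eq.symm
  let 𝒮 : Submonoid (Lp ℂ 2 μ →L[ℂ] Lp ℂ 2 μ) :=
    { carrier := Set.range (leftRegular μ)
      one_mem' := ⟨1, leftRegular_one μ⟩
      mul_mem' := by
        rintro _ _ ⟨x, rfl⟩ ⟨y, rfl⟩
        exact ⟨x * y, leftRegular_mul μ x y⟩ }
  have hstar : ∀ A ∈ 𝒮, star A ∈ 𝒮 := by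
    rintro _ ⟨x, rfl⟩
    exact ⟨x⁻¹, (star_leftRegular μ x).symm⟩
  refine ContinuousLinearMap.ext fun T => (hinner T).trans ?_
  refine inner_diagOp_eq_zero_of_mem_bicommutant hstar
    ((mem_groupVN_iff_mem_bicommutant μ).1 T.2) ?_
  rintro _ ⟨x, rfl⟩
  exact (hinner (leftRegularVN μ x)).symm.trans (h0 x)

theorem ext (h : IsNormalFunctional ω) (h' : IsNormalFunctional ω')
    (he : ∀ x, ω (leftRegularVN μ x) = ω' (leftRegularVN μ x)) : ω = ω' :=
  sub_eq_zero.1 ((h.sub h').eq_zero fun x => by simp [he x])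

end IsNormalFunctional

/-- The functional `T ↦ ⟨T f, g⟩` on the group von Neumann algebra. -/
def vectorFunctional (f g : Lp ℂ 2 μ) : GroupVN μ →L[ℂ] ℂ :=
  innerSL ℂ g ∘L ContinuousLinearMap.apply ℂ (Lp ℂ 2 μ) f ∘L
    (groupVN μ).toStarSubalgebra.toSubmodule.subtypeL

theorem isNormalFunctional_vectorFunctional (f g : Lp ℂ 2 μ) :
    IsNormalFunctional (vectorFunctional f g) :=
  IsNormalFunctional.of_countable (ι := Unit) (f := fun _ => f) (g := fun _ => g)
    .of_finite .of_finite fun T => hasSum_unique fun _ : Unit => ⟪g, T.1 f⟫_ℂ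

end NormalFunctionals

section NormalMultiplierMaps

variable {G : Type u} [Group G] [MeasurableSpace G] [MeasurableMul G]
  {μ : Measure G} [μ.IsMulLeftInvariant]

/-- A normal map on the group von Neumann algebra with `S(λ(x)) = φ(x) λ(x)`; it is the transpose
of the multiplication by `φ` on the Fourier algebra. -/
structure IsNormalMultiplierMap (φ : G → ℂ) (S : GroupVN μ →L[ℂ] GroupVN μ) : Prop where
  normal : ∀ ω : GroupVN μ →L[ℂ] ℂ, IsNormalFunctional ω → IsNormalFunctional (ω ∘L S)
  apply_leftRegular : ∀ x, S (leftRegularVN μ x) = φ x • leftRegularVN μ x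

namespace IsNormalMultiplierMap

variable {φ φ' : G → ℂ} {S S' : GroupVN μ →L[ℂ] GroupVN μ}

theorem represents (h : IsNormalMultiplierMap φ S) {ω : GroupVN μ →L[ℂ] ℂ} {ψ : G → ℂ}
    (hω : Represents ω ψ) : Represents (ω ∘L S) (φ * ψ) :=
  ⟨h.normal ω hω.1, fun x => by
    rw [ContinuousLinearMap.comp_apply, h.apply_leftRegular, map_smul, Pi.mul_apply, hω.2 x,
      smul_eq_mul]⟩

theorem isTransposeMultiplier (h : IsNormalMultiplierMap φ S) :
    IsTransposeMultiplier φ (S : GroupVN μ →ₗ[ℂ] GroupVN μ) := by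
  intro ψ ω ω' hω hω'
  have hrep := h.represents hω
  exact DFunLike.congr_fun (hrep.1.ext hω'.1 fun x => by rw [← hrep.2 x, hω'.2 x])

theorem mul_mem (h : IsNormalMultiplierMap φ S) {ψ : G → ℂ} (hψ : ψ ∈ fourierAlgebra μ) :
    φ * ψ ∈ fourierAlgebra μ := by
  obtain ⟨ω, hω⟩ := hψ
  exact ⟨_, h.represents hω⟩

theorem add (h : IsNormalMultiplierMap φ S) (h' : IsNormalMultiplierMap φ' S') :
    IsNormalMultiplierMap (φ + φ') (S + S') where
  normal ω hω := ω.comp_add S S' ▸ (h.normal ω hω).add (h'.normal ω hω)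
  apply_leftRegular x := by
    rw [add_apply, h.apply_leftRegular, h'.apply_leftRegular, Pi.add_apply, add_smul]

theorem smul (h : IsNormalMultiplierMap φ S) (c : ℂ) : IsNormalMultiplierMap (c • φ) (c • S) where
  normal ω hω := ω.comp_smul c S ▸ (h.normal ω hω).smul c
  apply_leftRegular x := by
    rw [smul_apply, h.apply_leftRegular, smul_smul, Pi.smul_apply, smul_eq_mul]

theorem zero : IsNormalMultiplierMap (0 : G → ℂ) (0 : GroupVN μ →L[ℂ] GroupVN μ) where
  normal ω _ := by
    rw [ContinuousLinearMap.comp_zero]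
    exact IsNormalFunctional.zero
  apply_leftRegular x := by simp

theorem sum {ι : Type*} (s : Finset ι) {φ : ι → G → ℂ} {S : ι → GroupVN μ →L[ℂ] GroupVN μ}
    (h : ∀ i, IsNormalMultiplierMap (φ i) (S i)) :
    IsNormalMultiplierMap (∑ i ∈ s, φ i) (∑ i ∈ s, S i) := by
  classical
  induction s using Finset.induction_on with
  | empty => exact zero
  | insert a s ha ih =>
    rw [Finset.sum_insert ha, Finset.sum_insert ha]
    exact (h a).add ih

end IsNormalMultiplierMap

end NormalMultiplierMaps

section SliceMaps

variable {ι H : Type*} [NormedAddCommGroup H] [InnerProductSpace ℂ H] [CompleteSpace H]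

/-- The normal completely bounded map `T ↦ W* (T ⊕ T ⊕ ⋯) V`. -/
def sliceOp (V W : H →L[ℂ] ℓ²(ι, H)) : (H →L[ℂ] H) →L[ℂ] (H →L[ℂ] H) :=
  LinearMap.mkContinuous
    { toFun := fun T => W.adjoint ∘L diagOp ι T ∘L V
      map_add' := fun S T => by
        ext v
        exact map_add W.adjoint (diagOp ι S (V v)) (diagOp ι T (V v))
      map_smul' := fun c T => by
        ext v
        exact map_smul W.adjoint c (diagOp ι T (V v)) }
    (‖W‖ * ‖V‖) fun T => calc
      ‖W.adjoint ∘L diagOp ι T ∘L V‖ ≤ ‖W.adjoint‖ * (‖diagOp ι T‖ * ‖V‖) :=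
        (ContinuousLinearMap.opNorm_comp_le _ _).trans
          (by gcongr; exact ContinuousLinearMap.opNorm_comp_le _ _)
      _ ≤ ‖W‖ * (‖T‖ * ‖V‖) := by
        rw [LinearIsometryEquiv.norm_map]
        gcongr
        exact norm_diagOp_le T
      _ = ‖W‖ * ‖V‖ * ‖T‖ := by ring

theorem inner_sliceOp (V W : H →L[ℂ] ℓ²(ι, H)) (T : H →L[ℂ] H) (ξ η : H) :
    ⟪η, sliceOp V W T ξ⟫_ℂ = ⟪W η, diagOp ι T (V ξ)⟫_ℂ :=
  ContinuousLinearMap.adjoint_inner_right W η (diagOp ι T (V ξ))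

theorem hasSum_inner_sliceOp (V W : H →L[ℂ] ℓ²(ι, H)) (T : H →L[ℂ] H) (ξ η : H) :
    HasSum (fun i => ⟪W η i, T (V ξ i)⟫_ℂ) ⟪η, sliceOp V W T ξ⟫_ℂ := by
  rw [inner_sliceOp]
  exact lp.hasSum_inner (W η) (diagOp ι T (V ξ))

omit [CompleteSpace H] in
theorem summable_norm_sq_apply (V : H →L[ℂ] ℓ²(ι, H)) {f : ℕ → H}
    (hf : Summable fun n => ‖f n‖ ^ 2) : Summable fun p : ℕ × ι => ‖V (f p.1) p.2‖ ^ 2 := by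
  rw [summable_prod_of_nonneg fun _ => by positivity]
  refine ⟨fun n => (hasSum_norm_sq_lp (V (f n))).summable, ?_⟩
  refine (hf.mul_left (‖V‖ ^ 2)).of_nonneg_of_le
    (fun n => tsum_nonneg fun _ => by positivity) fun n => ?_
  rw [(hasSum_norm_sq_lp (V (f n))).tsum_eq, ← mul_pow]
  gcongr
  exact V.le_opNorm _

variable {G : Type u} [Group G] [MeasurableSpace G] [MeasurableMul G]
  {μ : Measure G} [μ.IsMulLeftInvariant] [Countable ι] {V W : Lp ℂ 2 μ →L[ℂ] ℓ²(ι, Lp ℂ 2 μ)}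
  {φ : G → ℂ}

theorem sliceOp_mem_groupVN
    (h : ∀ x, sliceOp V W (leftRegular μ x) = φ x • leftRegular μ x) (T : GroupVN μ) :
    sliceOp V W T.1 ∈ (groupVN μ).toStarSubalgebra := by
  refine (mem_groupVN_iff_mem_bicommutant μ).2 fun C hC => ?_
  refine ContinuousLinearMap.ext fun ξ => ext_inner_left ℂ fun η => ?_
  let ω (ξ η : Lp ℂ 2 μ) : GroupVN μ →L[ℂ] ℂ := innerSL ℂ η ∘L
    ContinuousLinearMap.apply ℂ (Lp ℂ 2 μ) ξ ∘L sliceOp V W ∘L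
      (groupVN μ).toStarSubalgebra.toSubmodule.subtypeL
  have hω : ∀ ξ η, IsNormalFunctional (ω ξ η) := fun ξ η =>
    IsNormalFunctional.of_countable (hasSum_norm_sq_lp (V ξ)).summable
      (hasSum_norm_sq_lp (W η)).summable fun T => hasSum_inner_sliceOp V W T.1 ξ η
  have heq : ω ξ (C.adjoint η) = ω (C ξ) η := (hω _ _).ext (hω _ _) fun x => by
    change ⟪C.adjoint η, sliceOp V W (leftRegular μ x) ξ⟫_ℂ =
      ⟪η, sliceOp V W (leftRegular μ x) (C ξ)⟫_ℂ
    have hcomm := DFunLike.congr_fun (hC _ ⟨x, rfl⟩) ξ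
    simp only [mul_apply_eq_comp] at hcomm
    rw [ContinuousLinearMap.adjoint_inner_left, h, smul_apply, smul_apply, map_smul, hcomm]
  exact (ContinuousLinearMap.adjoint_inner_left C _ η).symm.trans (DFunLike.congr_fun heq T)

/-- The map `T ↦ W* (T ⊕ T ⊕ ⋯) V`, restricted to the group von Neumann algebra. -/
def sliceVN (V W : Lp ℂ 2 μ →L[ℂ] ℓ²(ι, Lp ℂ 2 μ))
    (h : ∀ x, sliceOp V W (leftRegular μ x) = φ x • leftRegular μ x) :
    GroupVN μ →L[ℂ] GroupVN μ :=
  (sliceOp V W ∘L (groupVN μ).toStarSubalgebra.toSubmodule.subtypeL).codRestrict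
    (groupVN μ).toStarSubalgebra.toSubmodule (sliceOp_mem_groupVN h)

theorem coe_sliceVN (h : ∀ x, sliceOp V W (leftRegular μ x) = φ x • leftRegular μ x)
    (T : GroupVN μ) : (sliceVN V W h T).1 = sliceOp V W T.1 :=
  rfl

theorem isNormalMultiplierMap_sliceVN
    (h : ∀ x, sliceOp V W (leftRegular μ x) = φ x • leftRegular μ x) :
    IsNormalMultiplierMap φ (sliceVN V W h) where
  normal ω hω := by
    obtain ⟨f, g, hf, hg, hω⟩ := hω
    have hf' := summable_norm_sq_apply V hf
    have hg' := summable_norm_sq_apply W hg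
    refine IsNormalFunctional.of_countable (ι := ℕ × ι) hf' hg' fun T => ?_
    have hsum := (lp.summable_inner (𝕜 := ℂ) ⟨_, memℓp_two_of_summable hg'⟩
      (diagOp _ T.1 ⟨_, memℓp_two_of_summable hf'⟩)).hasSum
    have hfiber := hsum.prod_fiberwise fun n => hasSum_inner_sliceOp V W T.1 (f n) (g n)
    rw [ContinuousLinearMap.comp_apply, (hω (sliceVN V W h T)).unique hfiber]
    exact hsum
  apply_leftRegular x := Subtype.ext (h x)

end SliceMaps

/-! ### From completely bounded multipliers to Herz–Schur multipliers -/

section MatrixOperators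

variable {G : Type u} [Group G] [MeasurableSpace G] [MeasurableMul G]
  {μ : Measure G} [μ.IsMulLeftInvariant] {n : ℕ}

theorem inner_matrixOperator (a : Matrix (Fin n) (Fin n) (GroupVN μ))
    (ξ η : PiLp 2 fun _ : Fin n => Lp ℂ 2 μ) :
    ⟪η, matrixOperator a ξ⟫_ℂ = ∑ i, ∑ j, ⟪η i, (a i j).1 (ξ j)⟫_ℂ := by
  rw [PiLp.inner_apply]
  refine Finset.sum_congr rfl fun i _ => ?_
  rw [← inner_sum]
  simp [matrixOperator]

variable (μ) in
/-- The matrix `(aᵢⱼ λ(xᵢ xⱼ⁻¹))` over the group von Neumann algebra, on which a multiplier `φ` acts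
as the Schur multiplier `(φ(xᵢ xⱼ⁻¹))`. -/
def translationMatrix (x : Fin n → G) (a : Fin n → Fin n → ℂ) :
    Matrix (Fin n) (Fin n) (GroupVN μ) :=
  fun i j => a i j • leftRegularVN μ (x i * (x j)⁻¹)

theorem translationMatrix_map {φ : G → ℂ} {S : GroupVN μ →ₗ[ℂ] GroupVN μ}
    (hS : ∀ x, S (leftRegularVN μ x) = φ x • leftRegularVN μ x) (x : Fin n → G)
    (a : Fin n → Fin n → ℂ) :
    (translationMatrix μ x a).map S =
      translationMatrix μ x fun i j => φ (x i * (x j)⁻¹) * a i j := by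
  ext1 i j
  simp only [translationMatrix, Matrix.map_apply, map_smul, hS, smul_smul, mul_comm]

theorem inner_leftRegular_mul_inv (x y : G) (f g : Lp ℂ 2 μ) :
    ⟪g, leftRegular μ (x * y⁻¹) f⟫_ℂ = ⟪leftRegular μ x⁻¹ g, leftRegular μ y⁻¹ f⟫_ℂ := by
  rw [leftRegular_mul, mul_apply_eq_comp, inner_leftRegular_right]

theorem inner_matrixOperator_translationMatrix (x : Fin n → G) (a : Fin n → Fin n → ℂ)
    (ξ η : PiLp 2 fun _ : Fin n => Lp ℂ 2 μ) :
    ⟪η, matrixOperator (translationMatrix μ x a) ξ⟫_ℂ =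
      ∑ i, ∑ j, a i j * ⟪leftRegular μ (x i)⁻¹ (η i), leftRegular μ (x j)⁻¹ (ξ j)⟫_ℂ := by
  simp only [inner_matrixOperator, ← inner_leftRegular_mul_inv, ← inner_smul_right]
  rfl

theorem norm_matrixOperator_translationMatrix_le {x : Fin n → G} {a : Fin n → Fin n → ℂ} {K : ℝ}
    (hK : 0 ≤ K) (ha : FormBound Finset.univ a K) :
    ‖matrixOperator (translationMatrix μ x a)‖ ≤ K := by
  refine ContinuousLinearMap.opNorm_le_of_re_inner_le hK fun ξ η hξ hη => ?_
  have hbound := ha.norm_sum_inner_le hK (fun j => leftRegular μ (x j)⁻¹ (ξ j))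
    fun i => leftRegular μ (x i)⁻¹ (η i)
  simp only [norm_leftRegular_apply, ← PiLp.norm_eq_of_L2, hξ, hη, mul_one,
    ← inner_matrixOperator_translationMatrix] at hbound
  rw [inner_re_symm]
  exact (RCLike.re_le_norm _).trans hbound

/-- Testing the matrix on the vectors `(ξⱼ λ(xⱼ) f)ⱼ` recovers the scalar matrix `a`. -/
theorem formBound_norm_matrixOperator_translationMatrix {f : Lp ℂ 2 μ} (hf : ‖f‖ = 1)
    (x : Fin n → G) (a : Fin n → Fin n → ℂ) :
    FormBound Finset.univ a ‖matrixOperator (translationMatrix μ x a)‖ := by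
  intro ξ η
  let vec (c : Fin n → ℂ) : PiLp 2 fun _ : Fin n => Lp ℂ 2 μ :=
    WithLp.toLp 2 fun i => c i • leftRegular μ (x i) f
  have hvec : ∀ c, ‖vec c‖ = √(∑ i, ‖c i‖ ^ 2) := fun c => by
    simp [vec, PiLp.norm_eq_of_L2, norm_smul, norm_leftRegular_apply, hf]
  have htranslate : ∀ c i, leftRegular μ (x i)⁻¹ (vec c i) = c i • f := fun c i => by
    simp only [vec, map_smul, ← mul_apply_eq_comp, ← leftRegular_mul, inv_mul_cancel,
      leftRegular_one, one_apply_eq_self]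
  have hform : ⟪vec fun i => starRingEnd ℂ (η i),
      matrixOperator (translationMatrix μ x a) (vec ξ)⟫_ℂ =
      ∑ i, ∑ j, a i j * ξ j * η i := by
    rw [inner_matrixOperator_translationMatrix]
    simp only [htranslate, inner_smul_left, inner_smul_right, inner_self_eq_norm_sq_to_K, hf,
      Complex.conj_conj, RCLike.ofReal_one, one_pow, mul_one, mul_assoc]
  rw [← hform, ← hvec ξ]
  simpa only [hvec, RCLike.norm_conj] using norm_inner_apply_le
    (matrixOperator (translationMatrix μ x a)) (vec ξ) (vec fun i => starRingEnd ℂ (η i))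

end MatrixOperators

section Necessity

variable {G : Type u} [Group G] [MeasurableSpace G] [MeasurableMul G]
  {μ : Measure G} [μ.IsMulLeftInvariant]

theorem herzSchurBound_of_cbNorm_le {φ : G → ℂ} {S : GroupVN μ →ₗ[ℂ] GroupVN μ} {k : ℝ}
    (hk : 0 ≤ k) (hS : ∀ x, S (leftRegularVN μ x) = φ x • leftRegularVN μ x)
    (hcb : cbNorm S ≤ ENNReal.ofReal k) {f : Lp ℂ 2 μ} (hf : ‖f‖ = 1) : HerzSchurBound φ k := by
  simp only [cbNorm, iSup_le_iff] at hcb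
  intro s a ha
  obtain ⟨n, x, rfl⟩ : ∃ (n : ℕ) (x : Fin n ↪ G), Finset.univ.map x = s :=
    ⟨s.card, s.equivFin.symm.toEmbedding.trans (.subtype _), by
      rw [← Finset.map_map, Finset.map_univ_equiv]
      exact Finset.attach_map_val⟩
  rw [formBound_map_iff] at ha ⊢
  have hA := norm_matrixOperator_translationMatrix_le (μ := μ) (x := x) zero_le_one ha
  have hSA : ‖matrixOperator ((translationMatrix μ x fun i j => a (x i) (x j)).map S)‖ ≤ k := by
    rw [← ENNReal.ofReal_le_ofReal_iff hk, ofReal_norm]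
    exact hcb n _ hA
  rw [translationMatrix_map hS] at hSA
  exact (formBound_norm_matrixOperator_translationMatrix hf x _).mono hSA

theorem IsTransposeMultiplier.apply_leftRegular [TopologicalSpace G] {φ : G → ℂ}
    (hφ : IsFourierMultiplier μ φ) {S : GroupVN μ →ₗ[ℂ] GroupVN μ}
    (hS : IsTransposeMultiplier φ S) (x : G) :
    S (leftRegularVN μ x) = φ x • leftRegularVN μ x := by
  refine Subtype.ext (ContinuousLinearMap.ext fun ξ => ext_inner_left ℂ fun η => ?_)
  have hω : Represents (vectorFunctional ξ η) fun x => vectorFunctional ξ η (leftRegularVN μ x) :=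
    ⟨isNormalFunctional_vectorFunctional ξ η, fun _ => rfl⟩
  obtain ⟨ω', hω'⟩ := hφ.2 _ ⟨_, hω⟩
  have htranspose := hS _ _ _ hω hω' (leftRegularVN μ x)
  rw [← hω'.2 x] at htranspose
  exact htranspose.trans (inner_smul_right η (leftRegular μ x ξ) (φ x)).symm

theorem herzSchurBound_of_cbMultiplierNorm_le [TopologicalSpace G] {φ : G → ℂ} {k : ℝ}
    (hk : 0 ≤ k) (h : cbMultiplierNorm μ φ ≤ ENNReal.ofReal k) {f : Lp ℂ 2 μ} (hf : ‖f‖ = 1) :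
    HerzSchurBound φ k := by
  refine HerzSchurBound.of_forall_pos_add fun ε hε => ?_
  have hlt : cbMultiplierNorm μ φ < ENNReal.ofReal (k + ε) :=
    h.trans_lt ((ENNReal.ofReal_lt_ofReal_iff (by positivity)).2 (by linarith))
  simp only [cbMultiplierNorm, iInf_lt_iff] at hlt
  obtain ⟨hφ, S, hS, hcb⟩ := hlt
  exact herzSchurBound_of_cbNorm_le (by positivity) (hS.apply_leftRegular hφ) hcb.le hf

theorem enorm_apply_le_fourierNorm (u : G → ℂ) (x : G) : ‖u x‖ₑ ≤ fourierNorm μ u := by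
  refine le_iInf₂ fun ω hω => ?_
  rw [hω.2 x, ← ofReal_norm, ← ofReal_norm]
  refine ENNReal.ofReal_le_ofReal (ω.unit_le_opNorm _ ?_)
  exact ContinuousLinearMap.opNorm_le_bound _ zero_le_one fun f => by
    rw [one_mul]
    exact (norm_leftRegular_apply μ x f).le

theorem herzSchurBound_inner_leftRegular (f g : Lp ℂ 2 μ) :
    HerzSchurBound (fun x => ⟪g, leftRegular μ x f⟫_ℂ) (‖f‖ * ‖g‖) := by
  intro s a ha ξ η
  have hbound := ha.norm_sum_inner_le zero_le_one (fun j => ξ j • leftRegular μ j⁻¹ f)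
    (fun i => starRingEnd ℂ (η i) • leftRegular μ i⁻¹ g)
  simp only [norm_smul, norm_leftRegular_apply, inner_smul_left, inner_smul_right,
    Complex.conj_conj, RCLike.norm_conj, mul_pow, ← Finset.sum_mul,
    Real.sqrt_mul (Finset.sum_nonneg fun _ _ => sq_nonneg _), Real.sqrt_sq (norm_nonneg _)]
    at hbound
  have hform : ∑ i ∈ s, ∑ j ∈ s, ⟪g, leftRegular μ (i * j⁻¹) f⟫_ℂ * a i j * ξ j * η i =
      ∑ i ∈ s, ∑ j ∈ s,
        a i j * (ξ j * (η i * ⟪leftRegular μ i⁻¹ g, leftRegular μ j⁻¹ f⟫_ℂ)) := by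
    refine Finset.sum_congr rfl fun i _ => Finset.sum_congr rfl fun j _ => ?_
    rw [inner_leftRegular_mul_inv]
    ring
  rw [hform]
  refine hbound.trans_eq ?_
  ring

end Necessity

section FiniteApproximation

variable {Λ : Type*} [Group Λ]

theorem HerzSchurBound.mono {φ : Λ → ℂ} {k l : ℝ} (h : HerzSchurBound φ k) (hkl : k ≤ l) :
    HerzSchurBound φ l :=
  fun s a ha => (h s a ha).mono hkl

theorem HasFiniteHerzSchurApproximation.of_forall_pos_add {k : ℝ} (hk : 0 < k)
    (h : ∀ δ > 0, HasFiniteHerzSchurApproximation Λ (k + δ)) :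
    HasFiniteHerzSchurApproximation Λ k := by
  intro F ε hε
  have hδ : 0 < k * (ε / 2) := by positivity
  obtain ⟨ψ, hfin, hψ, hF⟩ := h _ hδ F (ε / 2) (by positivity)
  set c : ℝ := k / (k + k * (ε / 2)) with hc
  have hc0 : 0 ≤ c := by positivity
  have hc1 : c ≤ 1 := (div_le_one (by positivity)).2 (by linarith)
  have hsub : 1 - c ≤ ε / 2 := by
    rw [hc, one_sub_div (by positivity), add_sub_cancel_left, div_le_iff₀ (by positivity)]
    nlinarith [mul_pos hδ hε]
  have hnorm : ‖(c : ℂ)‖ = c := RCLike.norm_of_nonneg hc0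
  refine ⟨fun x => c * ψ x, hfin.subset fun x hx => right_ne_zero_of_mul hx, ?_,
    fun x hx => ?_⟩
  · have hck : c * (k + k * (ε / 2)) = k := div_mul_cancel₀ k (by positivity)
    simpa only [hnorm, hck] using hψ.const_mul (c : ℂ)
  · calc ‖c * ψ x - 1‖ = ‖(c : ℂ) * (ψ x - 1) - ((1 - c : ℝ) : ℂ)‖ := by
          push_cast
          ring_nf
      _ ≤ c * ‖ψ x - 1‖ + (1 - c) := by
          refine (norm_sub_le _ _).trans_eq ?_
          rw [norm_mul, hnorm, Complex.norm_of_nonneg (sub_nonneg.2 hc1)]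
      _ < ε := by nlinarith [hF x hx, norm_nonneg (ψ x - 1)]

end FiniteApproximation

section CompactSupport

/-- `φ` is a limit of compactly supported functions in the Herz–Schur norm. -/
def IsHerzSchurLimitOfCompactSupport {G : Type*} [Group G] [TopologicalSpace G] (φ : G → ℂ) :
    Prop :=
  ∀ ε > 0, ∃ φ' : G → ℂ, HerzSchurBound (φ - φ') ε ∧
    ∃ K : Set G, IsCompact K ∧ ∀ x ∉ K, φ' x = 0

namespace IsHerzSchurLimitOfCompactSupport

variable {G : Type*} [Group G] [TopologicalSpace G] {φ ψ : G → ℂ}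

theorem zero : IsHerzSchurLimitOfCompactSupport (0 : G → ℂ) := fun ε hε =>
  ⟨0, fun s a _ ξ η => by simpa using by positivity, ∅, isCompact_empty, fun _ _ => rfl⟩

theorem add (hφ : IsHerzSchurLimitOfCompactSupport φ) (hψ : IsHerzSchurLimitOfCompactSupport ψ) :
    IsHerzSchurLimitOfCompactSupport (φ + ψ) := by
  intro ε hε
  obtain ⟨φ', hφφ', K, hK, hφ'⟩ := hφ (ε / 2) (by positivity)
  obtain ⟨ψ', hψψ', L, hL, hψ'⟩ := hψ (ε / 2) (by positivity)
  refine ⟨φ' + ψ', ?_, K ∪ L, hK.union hL, fun x hx => ?_⟩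
  · simpa only [add_halves, sub_add_sub_comm] using hφφ'.add hψψ'
  · rw [Set.mem_union, not_or] at hx
    rw [Pi.add_apply, hφ' x hx.1, hψ' x hx.2, add_zero]

theorem of_forall_herzSchurBound_sub (h : ∀ ε > 0, ∃ φ' : G → ℂ,
    IsHerzSchurLimitOfCompactSupport φ' ∧ HerzSchurBound (φ - φ') ε) :
    IsHerzSchurLimitOfCompactSupport φ := by
  intro ε hε
  obtain ⟨φ', hφ', hφφ'⟩ := h (ε / 2) (by positivity)
  obtain ⟨φ'', hφ'φ'', hK⟩ := hφ' (ε / 2) (by positivity)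
  exact ⟨φ'', by simpa only [sub_add_sub_cancel, add_halves] using hφφ'.add hφ'φ'', hK⟩

theorem exists_finite_support_subgroup (hφ : IsHerzSchurLimitOfCompactSupport φ)
    {Γ : Subgroup G} (hΓ : IsClosed (Γ : Set G)) [DiscreteTopology Γ] {δ : ℝ} (hδ : 0 < δ) :
    ∃ ψ : Γ → ℂ, (Function.support ψ).Finite ∧ HerzSchurBound (φ ∘ Γ.subtype - ψ) δ := by
  obtain ⟨φ', hφφ', K, hK, hφ'⟩ := hφ δ hδ
  refine ⟨φ' ∘ Γ.subtype, ?_, hφφ'.comp_injective Γ.subtype_injective⟩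
  have hcompact : IsCompact ((↑) ⁻¹' K : Set Γ) :=
    hΓ.isClosedEmbedding_subtypeVal.isCompact_preimage hK
  exact hcompact.finite_of_discrete.subset fun x hx => not_imp_comm.1 (hφ' x) hx

end IsHerzSchurLimitOfCompactSupport

theorem summable_norm_mul_norm {ι E F : Type*} [SeminormedAddCommGroup E]
    [SeminormedAddCommGroup F] {f : ι → E} {g : ι → F} (hf : Summable fun n => ‖f n‖ ^ 2)
    (hg : Summable fun n => ‖g n‖ ^ 2) : Summable fun n => ‖f n‖ * ‖g n‖ :=
  (hf.add hg).of_nonneg_of_le (fun _ => by positivity) fun n => by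
    nlinarith [sq_nonneg (‖f n‖ - ‖g n‖), sq_nonneg (‖f n‖), sq_nonneg ‖g n‖]

theorem nontrivial_Lp {X E : Type*} [MeasurableSpace X] [NormedAddCommGroup E] [Nontrivial E]
    {p : ℝ≥0∞} [hp : Fact (1 ≤ p)] (μ : Measure X) [SigmaFinite μ] [NeZero μ] :
    Nontrivial (Lp E p μ) := by
  obtain ⟨s, hs, -, hpos, hfin⟩ := Measure.exists_subset_measure_lt_top MeasurableSet.univ
    (Measure.measure_univ_pos.2 (NeZero.ne μ))
  obtain ⟨c, hc⟩ := exists_ne (0 : E)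
  refine ⟨indicatorConstLp p hs hfin.ne c, 0, norm_ne_zero_iff.1 ?_⟩
  have hreal : 0 < μ.real s := ENNReal.toReal_pos hpos.ne' hfin.ne
  rw [norm_indicatorConstLp' (zero_lt_one.trans_le hp.out).ne' hpos.ne']
  exact mul_ne_zero (norm_ne_zero_iff.2 hc) (by positivity)

theorem exists_compactSupport_norm_sub_le {X E : Type*} [TopologicalSpace X] [R1Space X]
    [NormalSpace X] [WeaklyLocallyCompactSpace X] [MeasurableSpace X] [BorelSpace X]
    [NormedAddCommGroup E] [NormedSpace ℝ E] {p : ℝ≥0∞} (hp : p ≠ ∞) {μ : Measure X} [μ.Regular]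
    (f : Lp E p μ) {ε : ℝ} (hε : 0 < ε) :
    ∃ (f' : Lp E p μ) (K : Set X), ‖f - f'‖ ≤ ε ∧ IsCompact K ∧ ∀ᵐ x ∂μ, x ∉ K → f' x = 0 := by
  obtain ⟨g, hgc, hg, -, hgm⟩ := (Lp.memLp f).exists_hasCompactSupport_eLpNorm_sub_le
    hp (ε := ENNReal.ofReal ε) (by simpa using hε)
  refine ⟨hgm.toLp g, tsupport g, ?_, hgc, ?_⟩
  · have hsub : f - hgm.toLp g = ((Lp.memLp f).sub hgm).toLp := by
      rw [MemLp.toLp_sub (Lp.memLp f) hgm, Lp.toLp_coeFn]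
    rw [hsub, Lp.norm_toLp]
    exact ENNReal.toReal_le_of_le_ofReal hε.le hg
  · filter_upwards [hgm.coeFn_toLp] with x hx hxK
    rw [hx, image_eq_zero_of_notMem_tsupport hxK]

section Measurable

variable {G : Type u} [Group G] [MeasurableSpace G] [MeasurableMul G] {μ : Measure G}
  [μ.IsMulLeftInvariant]

theorem herzSchurBound_inner_leftRegular_sub (f f' g g' : Lp ℂ 2 μ) :
    HerzSchurBound
      ((fun x => ⟪g, leftRegular μ x f⟫_ℂ) - fun x => ⟪g', leftRegular μ x f'⟫_ℂ)
      (‖f‖ * ‖g - g'‖ + ‖f - f'‖ * ‖g'‖) := by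
  convert (herzSchurBound_inner_leftRegular f (g - g')).add
    (herzSchurBound_inner_leftRegular (f - f') g') using 1
  ext x
  simp only [Pi.sub_apply, Pi.add_apply, map_sub, inner_sub_left, inner_sub_right,
    sub_add_sub_cancel]

theorem inner_leftRegular_eq_zero {f g : Lp ℂ 2 μ} {K L : Set G}
    (hg : ∀ᵐ x ∂μ, x ∉ K → g x = 0) (hf : ∀ᵐ x ∂μ, x ∉ L → f x = 0) {x : G} (hx : x ∉ K * L⁻¹) :
    ⟪g, leftRegular μ x f⟫_ℂ = 0 := by
  rw [L2.inner_def]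
  refine integral_eq_zero_of_ae ?_
  have hfx := (measurePreserving_mul_left μ x⁻¹).quasiMeasurePreserving.ae hf
  filter_upwards [hg, coeFn_leftRegular μ x f, hfx] with z hgz hcoe hfz
  rw [hcoe, Pi.zero_apply]
  by_cases hz : z ∈ K
  · have hxz : x⁻¹ * z ∉ L := fun hL => hx ⟨z, hz, (x⁻¹ * z)⁻¹, Set.inv_mem_inv.2 hL, by simp⟩
    rw [hfz hxz, inner_zero_right]
  · rw [hgz hz, inner_zero_left]

end Measurable

variable {G : Type u} [Group G] [TopologicalSpace G] [IsTopologicalGroup G]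
  [MeasurableSpace G] [BorelSpace G] {μ : Measure G}

section Regular

variable [LocallyCompactSpace G] [NormalSpace G] [μ.IsMulLeftInvariant] [μ.Regular]

theorem isHerzSchurLimitOfCompactSupport_inner_leftRegular (f g : Lp ℂ 2 μ) :
    IsHerzSchurLimitOfCompactSupport fun x => ⟪g, leftRegular μ x f⟫_ℂ := by
  intro ε hε
  obtain ⟨g', K, hg', hK, hgK⟩ := exists_compactSupport_norm_sub_le (by simp) g
    (ε := ε / 2 / (‖f‖ + 1)) (by positivity)
  obtain ⟨f', L, hf', hL, hfL⟩ := exists_compactSupport_norm_sub_le (by simp) f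
    (ε := ε / 2 / (‖g'‖ + 1)) (by positivity)
  refine ⟨_, (herzSchurBound_inner_leftRegular_sub f f' g g').mono ?_, K * L⁻¹, hK.mul hL.inv,
    fun x hx => inner_leftRegular_eq_zero hgK hfL hx⟩
  calc ‖f‖ * ‖g - g'‖ + ‖f - f'‖ * ‖g'‖
      ≤ (‖f‖ + 1) * (ε / 2 / (‖f‖ + 1)) + ε / 2 / (‖g'‖ + 1) * (‖g'‖ + 1) := by gcongr <;> simp
    _ = ε := by
      field_simp
      ring

theorem isHerzSchurLimitOfCompactSupport_of_mem_fourierAlgebra {φ : G → ℂ}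
    (hφ : φ ∈ fourierAlgebra μ) : IsHerzSchurLimitOfCompactSupport φ := by
  obtain ⟨ω, ⟨f, g, hf, hg, hω⟩, hφω⟩ := hφ
  have hsum := summable_norm_mul_norm hf hg
  let c : ℕ → G → ℂ := fun n x => ⟪g n, leftRegular μ x (f n)⟫_ℂ
  refine .of_forall_herzSchurBound_sub fun ε hε => ?_
  obtain ⟨N, hN⟩ := ((tendsto_sum_nat_add fun n => ‖f n‖ * ‖g n‖).eventually_le_const hε).exists
  refine ⟨∑ n ∈ Finset.range N, c n, Finset.sum_induction _ _ (fun _ _ => .add) .zero fun n _ =>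
    isHerzSchurLimitOfCompactSupport_inner_leftRegular (f n) (g n), .mono ?_ hN⟩
  refine HerzSchurBound.of_hasSum (φ' := fun n => c (n + N)) (fun x => ?_)
    ((summable_nat_add_iff N).2 hsum).hasSum fun n => herzSchurBound_inner_leftRegular _ _
  rw [Pi.sub_apply, Finset.sum_apply, hφω x]
  exact (hasSum_nat_add_iff' N).2 (hω (leftRegularVN μ x))

end Regular

theorem tendsto_apply_of_tendsto_fourierNorm [μ.IsMulLeftInvariant] {ι : Type*} {l : Filter ι}
    {φ : ι → G → ℂ}
    (h : ∀ ψ ∈ fourierAlgebra μ, Tendsto (fun α => fourierNorm μ (φ α * ψ - ψ)) l (𝓝 0))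
    {f : Lp ℂ 2 μ} (hf : ‖f‖ = 1) (x : G) : Tendsto (fun α => φ α x) l (𝓝 1) := by
  let ψ : G → ℂ := fun y => vectorFunctional f (leftRegular μ x f) (leftRegularVN μ y)
  have hψ : ψ ∈ fourierAlgebra μ := ⟨_, isNormalFunctional_vectorFunctional _ _, fun _ => rfl⟩
  have hψx : ψ x = 1 := by
    change ⟪leftRegular μ x f, leftRegular μ x f⟫_ℂ = 1
    rw [inner_self_eq_norm_sq_to_K, norm_leftRegular_apply, hf, RCLike.ofReal_one, one_pow]
  rw [tendsto_iff_enorm_sub_tendsto_zero]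
  refine tendsto_of_tendsto_of_tendsto_of_le_of_le tendsto_const_nhds (h ψ hψ)
    (fun _ => zero_le) fun α => ?_
  simpa only [Pi.sub_apply, Pi.mul_apply, hψx, mul_one] using
    enorm_apply_le_fourierNorm (μ := μ) (φ α * ψ - ψ) x

theorem HasCBApproximateUnit.hasFiniteHerzSchurApproximation [LocallyCompactSpace G]
    [NormalSpace G] [μ.IsHaarMeasure] [μ.Regular] [SigmaFinite μ] {k : ℝ} (hk : 0 < k)
    (h : HasCBApproximateUnit μ k) {Γ : Subgroup G} (hΓ : IsClosed (Γ : Set G))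
    [DiscreteTopology Γ] : HasFiniteHerzSchurApproximation Γ k := by
  obtain ⟨ι, _, _, _, φ, hφ, hlim, hcb⟩ := h
  have := nontrivial_Lp (E := ℂ) (p := 2) μ
  obtain ⟨f, hf⟩ := exists_norm_eq (Lp ℂ 2 μ) zero_le_one
  refine .of_forall_pos_add hk fun δ hδ F ε hε => ?_
  have hnear : ∀ᶠ α in atTop, ∀ x ∈ F, ‖φ α (x : G) - 1‖ < ε / 2 := by
    rw [Filter.eventually_all_finset]
    intro x _
    simpa only [dist_eq_norm] using Metric.tendsto_nhds.1
      (tendsto_apply_of_tendsto_fourierNorm hlim hf (x : G)) (ε / 2) (by positivity)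
  obtain ⟨α, hα⟩ := hnear.exists
  have hφα := (herzSchurBound_of_cbMultiplierNorm_le hk.le (hcb α) hf).comp_injective
    Γ.subtype_injective
  obtain ⟨ψ, hfin, hφψ⟩ :=
    (isHerzSchurLimitOfCompactSupport_of_mem_fourierAlgebra (hφ α)).exists_finite_support_subgroup
      hΓ (δ := min δ (ε / 2)) (by positivity)
  refine ⟨ψ, hfin, ?_, fun x hx => ?_⟩
  · have hψ := hφα.add (hφψ.const_mul (-1))
    refine (show HerzSchurBound ψ _ by convert hψ using 1; ext; simp).mono ?_
    simp
  · calc ‖ψ x - 1‖ = ‖(φ α x - 1) - (φ α ∘ Γ.subtype - ψ) x‖ := by simp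
      _ ≤ ‖φ α x - 1‖ + ‖(φ α ∘ Γ.subtype - ψ) x‖ := norm_sub_le _ _
      _ < ε := by linarith [hα x hx, hφψ.norm_le x, min_le_right δ (ε / 2)]

end CompactSupport

/-! ### Multiplication operators and Hilbert space valued functions -/

section HilbertBases

theorem exists_countable_hilbertBasis (E : Type*) [NormedAddCommGroup E] [InnerProductSpace ℂ E]
    [CompleteSpace E] [SecondCountableTopology E] :
    ∃ w : Set E, Countable w ∧ Nonempty (HilbertBasis w ℂ E) := by
  obtain ⟨w, b, -⟩ := exists_hilbertBasis ℂ E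
  refine ⟨w, Set.countable_univ_iff.1 ?_, ⟨b⟩⟩
  have hdist : ∀ i j, i ≠ j → 1 ≤ dist (b i) (b j) := fun i j hij => by
    have hsq : ‖b i - b j‖ ^ 2 = 2 := by
      rw [norm_sub_sq (𝕜 := ℂ), b.orthonormal.1 i, b.orthonormal.1 j, b.orthonormal.2 hij]
      norm_num
    rw [dist_eq_norm]
    nlinarith [norm_nonneg (b i - b j)]
  have hdisj : (Set.univ : Set w).PairwiseDisjoint fun i => Metric.ball (b i) (1 / 2) :=
    fun i _ j _ hij => Metric.ball_disjoint_ball (by linarith [hdist i j hij])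
  exact hdisj.countable_of_isOpen (fun _ _ => Metric.isOpen_ball)
    fun i _ => ⟨b i, Metric.mem_ball_self (by norm_num)⟩

variable {ι E : Type*} [NormedAddCommGroup E] [InnerProductSpace ℂ E] (b : HilbertBasis ι ℂ E)

theorem hasSum_conj_inner_mul_inner (x y : E) :
    HasSum (fun m => starRingEnd ℂ ⟪b m, x⟫_ℂ * ⟪b m, y⟫_ℂ) ⟪x, y⟫_ℂ := by
  simpa only [inner_conj_symm] using b.hasSum_inner_mul_inner x y

theorem sum_norm_inner_sq_le (x : E) (s : Finset ι) : ∑ m ∈ s, ‖⟪b m, x⟫_ℂ‖ ^ 2 ≤ ‖x‖ ^ 2 :=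
  b.orthonormal.sum_inner_products_le x

theorem hasSum_prod_norm_inner_sq {κ : Type*} {x : κ → E} {r : ℝ}
    (hx : HasSum (fun γ => ‖x γ‖ ^ 2) r) :
    HasSum (fun p : κ × ι => ‖⟪b p.2, x p.1⟫_ℂ‖ ^ 2) r := by
  have hnorm : ∀ γ, HasSum (fun m => ‖⟪b m, x γ⟫_ℂ‖ ^ 2) (‖x γ‖ ^ 2) := fun γ => by
    simpa only [b.repr_apply_apply, LinearIsometryEquiv.norm_map] using
      hasSum_norm_sq_lp (b.repr (x γ))
  have hsum : Summable fun p : κ × ι => ‖⟪b p.2, x p.1⟫_ℂ‖ ^ 2 := by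
    refine (summable_prod_of_nonneg fun _ => by positivity).2 ⟨fun γ => (hnorm γ).summable, ?_⟩
    simpa only [(hnorm _).tsum_eq] using hx.summable
  exact hx.unique (hsum.hasSum.prod_fiberwise hnorm) ▸ hsum.hasSum

theorem hasSum_prod_conj_inner_mul_inner {κ : Type*} {x y : κ → E} {w : ℂ}
    (hx : Summable fun γ => ‖x γ‖ ^ 2) (hy : Summable fun γ => ‖y γ‖ ^ 2)
    (hw : HasSum (fun γ => ⟪x γ, y γ⟫_ℂ) w) :
    HasSum (fun p : κ × ι => starRingEnd ℂ ⟪b p.2, x p.1⟫_ℂ * ⟪b p.2, y p.1⟫_ℂ) w := by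
  have hsum := (lp.summable_inner (𝕜 := ℂ)
    ⟨_, memℓp_two_of_summable (hasSum_prod_norm_inner_sq b hx.hasSum).summable⟩
    ⟨_, memℓp_two_of_summable (hasSum_prod_norm_inner_sq b hy.hasSum).summable⟩).hasSum
  simp only [RCLike.inner_apply'] at hsum
  exact hw.unique (hsum.prod_fiberwise fun γ => hasSum_conj_inner_mul_inner b (x γ) (y γ)) ▸ hsum

end HilbertBases

section ColumnOperators

variable {X κ : Type*} [MeasurableSpace X]

/-- The functions `g m` are the coordinates of a bounded measurable function from `X` to a Hilbert
space, with values of norm at most `√C`. -/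
structure IsBoundedColumn (g : κ → X → ℂ) (C : ℝ) : Prop where
  measurable : ∀ m, Measurable (g m)
  sum_sq_le : ∀ z (s : Finset κ), ∑ m ∈ s, ‖g m z‖ ^ 2 ≤ C

theorem integral_norm_sq_eq {ν : Measure X} (f : Lp ℂ 2 ν) : ∫ z, ‖f z‖ ^ 2 ∂ν = ‖f‖ ^ 2 := by
  have hinner := L2.inner_def (𝕜 := ℂ) f f
  simp only [inner_self_eq_norm_sq_to_K, ← Complex.ofReal_pow, Complex.coe_algebraMap] at hinner
  rw [integral_complex_ofReal] at hinner
  exact_mod_cast hinner.symm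

theorem integrable_norm_sq {ν : Measure X} (f : Lp ℂ 2 ν) : Integrable (fun z => ‖f z‖ ^ 2) ν :=
  (Lp.memLp f).integrable_norm_pow two_ne_zero

theorem integral_norm_inner_le {ν : Measure X} (f g : Lp ℂ 2 ν) :
    ∫ z, ‖⟪f z, g z⟫_ℂ‖ ∂ν ≤ (‖f‖ ^ 2 + ‖g‖ ^ 2) / 2 := by
  rw [← integral_norm_sq_eq, ← integral_norm_sq_eq,
    ← integral_add (integrable_norm_sq f) (integrable_norm_sq g), ← integral_div]
  refine integral_mono (L2.integrable_inner f g).norm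
    (((integrable_norm_sq f).add (integrable_norm_sq g)).div_const 2) fun z => ?_
  have hcs : ‖⟪f z, g z⟫_ℂ‖ ≤ ‖f z‖ * ‖g z‖ := norm_inner_le_norm _ _
  change ‖⟪f z, g z⟫_ℂ‖ ≤ (‖f z‖ ^ 2 + ‖g z‖ ^ 2) / 2
  linarith [two_mul_le_add_sq ‖f z‖ ‖g z‖]

namespace IsBoundedColumn

variable {g h : κ → X → ℂ} {C C' : ℝ}

theorem memLp_top (hg : IsBoundedColumn g C) (ν : Measure X) (m : κ) : MemLp (g m) ∞ ν :=
  memLp_top_of_bound (hg.measurable m).aestronglyMeasurable √C <| ae_of_all _ fun z =>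
    Real.le_sqrt_of_sq_le (by simpa using hg.sum_sq_le z {m})

theorem comp (hg : IsBoundedColumn g C) {Y : Type*} [MeasurableSpace Y] {f : Y → X}
    (hf : Measurable f) : IsBoundedColumn (fun m z => g m (f z)) C :=
  ⟨fun m => (hg.measurable m).comp hf, fun z => hg.sum_sq_le (f z)⟩

/-- Multiplication by `g m` on `L²`. -/
def mulOp (hg : IsBoundedColumn g C) (ν : Measure X) (m : κ) : Lp ℂ 2 ν →L[ℂ] Lp ℂ 2 ν :=
  (ContinuousLinearMap.mul ℂ ℂ).holderL ν ∞ 2 2 (hg.memLp_top ν m).toLp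

theorem coeFn_mulOp (hg : IsBoundedColumn g C) {ν : Measure X} (m : κ) (ξ : Lp ℂ 2 ν) :
    hg.mulOp ν m ξ =ᵐ[ν] fun z => g m z * ξ z := by
  filter_upwards [ContinuousLinearMap.coeFn_holder (r := 2) (ContinuousLinearMap.mul ℂ ℂ)
    (hg.memLp_top ν m).toLp ξ, (hg.memLp_top ν m).coeFn_toLp] with z hz hgz
  rw [← hgz]
  exact hz

theorem sum_norm_mulOp_sq_le (hg : IsBoundedColumn g C) {ν : Measure X} (ξ : Lp ℂ 2 ν)
    (s : Finset κ) : ∑ m ∈ s, ‖hg.mulOp ν m ξ‖ ^ 2 ≤ C * ‖ξ‖ ^ 2 := by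
  simp only [← integral_norm_sq_eq]
  rw [← integral_finsetSum _ fun m _ => integrable_norm_sq _, ← integral_const_mul]
  refine integral_mono_ae (integrable_finsetSum _ fun m _ => integrable_norm_sq _)
    ((integrable_norm_sq ξ).const_mul C) ?_
  filter_upwards [s.eventually_all.2 fun m _ => hg.coeFn_mulOp m ξ] with z hz
  rw [Finset.sum_congr rfl fun m hm => by rw [hz m hm, norm_mul, mul_pow], ← Finset.sum_mul]
  gcongr
  exact hg.sum_sq_le z s

/-- The operator `ξ ↦ (g m ξ)ₘ` from `L²` to a Hilbert sum of copies of `L²`. -/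
def columnOp (hg : IsBoundedColumn g C) (ν : Measure X) : Lp ℂ 2 ν →L[ℂ] ℓ²(κ, Lp ℂ 2 ν) :=
  LinearMap.mkContinuous
    { toFun := fun ξ => ⟨fun m => hg.mulOp ν m ξ, memℓp_two_of_summable <|
        summable_of_sum_le (fun _ => by positivity) (hg.sum_norm_mulOp_sq_le ξ)⟩
      map_add' := fun ξ η => by
        ext m : 2
        exact map_add (hg.mulOp ν m) ξ η
      map_smul' := fun c ξ => by
        ext m : 2
        exact map_smul (hg.mulOp ν m) c ξ }
    √|C| fun ξ => by
      refine lp.norm_le_of_forall_sum_le (by norm_num) (by positivity) fun s => ?_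
      simp only [ENNReal.toReal_ofNat, Real.rpow_two, mul_pow, Real.sq_sqrt (abs_nonneg C)]
      exact (hg.sum_norm_mulOp_sq_le ξ s).trans (by gcongr; exact le_abs_self C)

@[simp]
theorem columnOp_apply (hg : IsBoundedColumn g C) {ν : Measure X} (ξ : Lp ℂ 2 ν) (m : κ) :
    hg.columnOp ν ξ m = hg.mulOp ν m ξ :=
  rfl

theorem inner_columnOp [Countable κ] (hg : IsBoundedColumn g C) (hh : IsBoundedColumn h C')
    {ν : Measure X} {w : X → ℂ} (hw : ∀ z, HasSum (fun m => starRingEnd ℂ (h m z) * g m z) (w z))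
    (ξ η : Lp ℂ 2 ν) :
    ⟪hh.columnOp ν η, hg.columnOp ν ξ⟫_ℂ = ∫ z, w z * ⟪η z, ξ z⟫_ℂ ∂ν := by
  have hsummable : Summable fun m => ∫ z, ‖⟪hh.mulOp ν m η z, hg.mulOp ν m ξ z⟫_ℂ‖ ∂ν :=
    (((hasSum_norm_sq_lp (hh.columnOp ν η)).add
      (hasSum_norm_sq_lp (hg.columnOp ν ξ))).div_const 2).summable.of_nonneg_of_le
      (fun _ => by positivity) fun m => integral_norm_inner_le _ _
  have hsum := hasSum_integral_of_summable_integral_norm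
    (fun m => L2.integrable_inner (hh.mulOp ν m η) (hg.mulOp ν m ξ)) hsummable
  simp only [← L2.inner_def] at hsum
  rw [(lp.hasSum_inner (hh.columnOp ν η) (hg.columnOp ν ξ)).unique hsum]
  refine integral_congr_ae ?_
  filter_upwards [ae_all_iff.2 fun m => hh.coeFn_mulOp m η,
    ae_all_iff.2 fun m => hg.coeFn_mulOp m ξ] with z hη hξ
  refine (((hw z).mul_right ⟪η z, ξ z⟫_ℂ).congr_fun fun m => ?_).tsum_eq
  rw [hη m, hξ m, RCLike.inner_apply', RCLike.inner_apply', map_mul]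
  ring

theorem inner_columnOp_of_const [Countable κ] (hg : IsBoundedColumn g C)
    (hh : IsBoundedColumn h C') {ν : Measure X} {w : ℂ}
    (hw : ∀ z, HasSum (fun m => starRingEnd ℂ (h m z) * g m z) w) (ξ η : Lp ℂ 2 ν) :
    ⟪hh.columnOp ν η, hg.columnOp ν ξ⟫_ℂ = w * ⟪η, ξ⟫_ℂ := by
  rw [hg.inner_columnOp hh hw, integral_const_mul, L2.inner_def]

theorem diagOp_columnOp_const {c : κ → ℂ} (hc : IsBoundedColumn (fun m (_ : X) => c m) C)
    {ν : Measure X} (T : Lp ℂ 2 ν →L[ℂ] Lp ℂ 2 ν) (ξ : Lp ℂ 2 ν) :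
    diagOp κ T (hc.columnOp ν ξ) = hc.columnOp ν (T ξ) := by
  have hsmul : ∀ m (η : Lp ℂ 2 ν), hc.mulOp ν m η = c m • η := fun m η => Lp.ext <| by
    filter_upwards [hc.coeFn_mulOp m η, Lp.coeFn_smul (c m) η] with z hz hz'
    rw [hz, hz', Pi.smul_apply, smul_eq_mul]
  ext m : 2
  rw [diagOp_apply, columnOp_apply, columnOp_apply, hsmul, hsmul, map_smul]

variable {G : Type u} [Group G] [MeasurableSpace G] [MeasurableMul G] {μ : Measure G}
  [μ.IsMulLeftInvariant] {g h : κ → G → ℂ}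

theorem leftRegular_mulOp (hg : IsBoundedColumn g C) (x : G) (m : κ) (ξ : Lp ℂ 2 μ) :
    leftRegular μ x (hg.mulOp μ m ξ) =
      (hg.comp (measurable_const_mul x⁻¹)).mulOp μ m (leftRegular μ x ξ) := by
  refine Lp.ext ?_
  filter_upwards [coeFn_leftRegular μ x (hg.mulOp μ m ξ), coeFn_leftRegular μ x ξ,
    (measurePreserving_mul_left μ x⁻¹).quasiMeasurePreserving.ae (hg.coeFn_mulOp m ξ),
    (hg.comp (measurable_const_mul x⁻¹)).coeFn_mulOp m (leftRegular μ x ξ)] with z h1 h2 h3 h4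
  rw [h1, h3, h4, h2]

theorem sliceOp_columnOp_leftRegular [Countable κ] (hg : IsBoundedColumn g C)
    (hh : IsBoundedColumn h C') {x : G} {w : ℂ}
    (hw : ∀ z, HasSum (fun m => starRingEnd ℂ (h m z) * g m (x⁻¹ * z)) w) :
    sliceOp (hg.columnOp μ) (hh.columnOp μ) (leftRegular μ x) = w • leftRegular μ x := by
  refine ContinuousLinearMap.ext fun ξ => ext_inner_left ℂ fun η => ?_
  have hdiag : diagOp κ (leftRegular μ x) (hg.columnOp μ ξ) =
      (hg.comp (measurable_const_mul x⁻¹)).columnOp μ (leftRegular μ x ξ) := by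
    ext m : 2
    exact hg.leftRegular_mulOp x m ξ
  rw [inner_sliceOp, hdiag, inner_columnOp_of_const _ hh hw, smul_apply, inner_smul_right]

end IsBoundedColumn

end ColumnOperators

/-! ### Lattice domains -/

section LatticeDomains

variable {G : Type u} [Group G] [MeasurableSpace G]

/-- `D` is a Borel fundamental domain of finite measure for right translation by `Γ`, and `μ` is
invariant under right translation by `Γ`. -/
structure IsLatticeDomain (μ : Measure G) (Γ : Subgroup G) (D : Set G) : Prop where
  measurableSet : MeasurableSet D
  measure_ne_zero : μ D ≠ 0
  measure_ne_top : μ D ≠ ∞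
  exists_mem : ∀ z : G, ∃ γ : Γ, z * (γ : G)⁻¹ ∈ D
  eq_of_mem : ∀ (z : G) (γ γ' : Γ), z * (γ : G)⁻¹ ∈ D → z * (γ' : G)⁻¹ ∈ D → γ = γ'
  measurePreserving : ∀ γ : Γ, MeasurePreserving (fun z : G => z * (γ : G)) μ μ

/-- The translate `D γ`. -/
def tile {Γ : Subgroup G} (D : Set G) (γ : Γ) : Set G := (fun z => z * (γ : G)⁻¹) ⁻¹' D

/-- The part of the domain `D` that left translation by `z` moves into the tile `D γ`. -/
def blockSet {Γ : Subgroup G} (D : Set G) (γ : Γ) (z : G) : Set G :=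
  D ∩ (fun q => z * q) ⁻¹' tile D γ

namespace IsLatticeDomain

variable {μ : Measure G} {Γ : Subgroup G} {D : Set G}

theorem measureReal_pos (hD : IsLatticeDomain μ Γ D) : 0 < μ.real D :=
  ENNReal.toReal_pos hD.measure_ne_zero hD.measure_ne_top

theorem iUnion_tile (hD : IsLatticeDomain μ Γ D) : ⋃ γ : Γ, tile D γ = Set.univ :=
  Set.eq_univ_of_forall fun z => Set.mem_iUnion.2 (hD.exists_mem z)

theorem pairwise_disjoint_tile (hD : IsLatticeDomain μ Γ D) :
    Pairwise fun γ γ' : Γ => Disjoint (tile D γ) (tile D γ') := fun γ γ' h =>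
  Set.disjoint_left.2 fun z hz hw => h (hD.eq_of_mem z γ γ' hz hw)

theorem measure_blockSet_ne_top (hD : IsLatticeDomain μ Γ D) (γ : Γ) (z : G) :
    μ (blockSet D γ z) ≠ ∞ :=
  measure_ne_top_of_subset Set.inter_subset_left hD.measure_ne_top

theorem measure_tile (hD : IsLatticeDomain μ Γ D) (γ : Γ) : μ (tile D γ) = μ D :=
  (hD.measurePreserving γ⁻¹).measure_preimage hD.measurableSet.nullMeasurableSet

variable [MeasurableMul G]

theorem measurableSet_tile (hD : IsLatticeDomain μ Γ D) (γ : Γ) : MeasurableSet (tile D γ) :=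
  hD.measurableSet.preimage (measurable_mul_const _)

theorem measurableSet_blockSet (hD : IsLatticeDomain μ Γ D) (γ : Γ) (z : G) :
    MeasurableSet (blockSet D γ z) :=
  hD.measurableSet.inter ((hD.measurableSet_tile γ).preimage (measurable_const_mul z))

theorem hasSum_measureReal_inter_preimage_tile [Countable Γ] (hD : IsLatticeDomain μ Γ D)
    {A : Set G} (hA : MeasurableSet A) (hA' : μ A ≠ ∞) {f : G → G} (hf : Measurable f) :
    HasSum (fun γ : Γ => μ.real (A ∩ f ⁻¹' tile D γ)) (μ.real A) := by
  have hunion : A = ⋃ γ : Γ, A ∩ f ⁻¹' tile D γ := by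
    rw [← Set.inter_iUnion, ← Set.preimage_iUnion, hD.iUnion_tile, Set.preimage_univ,
      Set.inter_univ]
  have hdisj : Pairwise (Function.onFun Disjoint fun γ : Γ => A ∩ f ⁻¹' tile D γ) := fun γ γ' h =>
    ((hD.pairwise_disjoint_tile h).preimage f).mono Set.inter_subset_right Set.inter_subset_right
  have hmeasure : μ A = ∑' γ : Γ, μ (A ∩ f ⁻¹' tile D γ) := by
    conv_lhs => rw [hunion]
    exact measure_iUnion hdisj fun γ => hA.inter ((hD.measurableSet_tile γ).preimage hf)
  rw [measureReal_def, hmeasure, ENNReal.tsum_toReal_eq fun γ =>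
    measure_ne_top_of_subset Set.inter_subset_left hA']
  exact (ENNReal.summable_toReal (hmeasure ▸ hA')).hasSum

/-- Unfolding: the right translates of `D` tile the group. -/
theorem hasSum_measureReal_inter_preimage_mul_inv [Countable Γ] (hD : IsLatticeDomain μ Γ D)
    {A : Set G} (hA : MeasurableSet A) (hA' : μ A ≠ ∞) :
    HasSum (fun γ : Γ => μ.real (D ∩ (fun q => q * (γ : G)⁻¹) ⁻¹' A)) (μ.real A) := by
  have hsum := (Equiv.inv Γ).hasSum_iff.2
    (hD.hasSum_measureReal_inter_preimage_tile hA hA' measurable_id)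
  refine hsum.congr_fun fun γ => ?_
  have hset : D ∩ (fun q => q * (γ : G)⁻¹) ⁻¹' A =
      (fun q => q * ((γ⁻¹ : Γ) : G)) ⁻¹' (A ∩ tile D γ⁻¹) := by
    ext q
    simp [tile, and_comm]
  rw [hset, measureReal_def, (hD.measurePreserving γ⁻¹).measure_preimage
    (hA.inter (hD.measurableSet_tile _)).nullMeasurableSet]
  rfl

/-- The indicator function of `blockSet D γ z`. -/
def blockVector (hD : IsLatticeDomain μ Γ D) (γ : Γ) (z : G) : Lp ℂ 2 μ :=
  indicatorConstLp 2 (hD.measurableSet_blockSet γ z) (hD.measure_blockSet_ne_top γ z) 1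

theorem inner_blockVector (hD : IsLatticeDomain μ Γ D) (γ γ' : Γ) (z z' : G) :
    ⟪hD.blockVector γ z, hD.blockVector γ' z'⟫_ℂ =
      (μ.real (blockSet D γ z ∩ blockSet D γ' z') : ℂ) :=
  L2.inner_indicatorConstLp_one_indicatorConstLp_one _ _ _ _

theorem norm_blockVector_sq (hD : IsLatticeDomain μ Γ D) (γ : Γ) (z : G) :
    ‖hD.blockVector γ z‖ ^ 2 = μ.real (blockSet D γ z) := by
  have h := hD.inner_blockVector γ γ z z
  simp only [inner_self_eq_norm_sq_to_K, Set.inter_self, Complex.coe_algebraMap] at h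
  exact_mod_cast h

theorem hasSum_norm_blockVector_sq [Countable Γ] (hD : IsLatticeDomain μ Γ D) (σ : Γ) (z : G) :
    HasSum (fun γ => ‖hD.blockVector (σ * γ) z‖ ^ 2) (μ.real D) := by
  have hsum : HasSum (fun γ : Γ => ‖hD.blockVector γ z‖ ^ 2) (μ.real D) := by
    simp only [norm_blockVector_sq]
    exact hD.hasSum_measureReal_inter_preimage_tile hD.measurableSet hD.measure_ne_top
      (measurable_const_mul z)
  have hshift := (Equiv.mulLeft σ).hasSum_iff.2 hsum
  exact hshift

theorem hasSum_inner_blockVector [Countable Γ] [μ.IsMulLeftInvariant] (hD : IsLatticeDomain μ Γ D)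
    (σ : Γ) (x z : G) :
    HasSum (fun γ => ⟪hD.blockVector (σ * γ) z, hD.blockVector γ (x⁻¹ * z)⟫_ℂ)
      (μ.real (tile D σ ∩ (fun q => x⁻¹ * q) ⁻¹' D) : ℂ) := by
  have hA : MeasurableSet (tile D σ ∩ (fun q => x⁻¹ * q) ⁻¹' D) :=
    (hD.measurableSet_tile σ).inter (hD.measurableSet.preimage (measurable_const_mul _))
  have hmeasure : μ ((fun q => z * q) ⁻¹' (tile D σ ∩ (fun q => x⁻¹ * q) ⁻¹' D)) =
      μ (tile D σ ∩ (fun q => x⁻¹ * q) ⁻¹' D) :=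
    (measurePreserving_mul_left μ z).measure_preimage hA.nullMeasurableSet
  have hsum := hD.hasSum_measureReal_inter_preimage_mul_inv (hA.preimage (measurable_const_mul z))
    (hmeasure ▸ measure_ne_top_of_subset Set.inter_subset_left
      ((hD.measure_tile σ).trans_ne hD.measure_ne_top))
  rw [measureReal_def, hmeasure] at hsum
  refine (Complex.hasSum_ofReal.2 hsum).congr_fun fun γ => ?_
  rw [inner_blockVector]
  congr 2
  ext q
  simp only [blockSet, tile, Set.mem_inter_iff, Set.mem_preimage, Subgroup.coe_mul, mul_inv_rev,
    mul_assoc]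
  tauto

theorem inner_blockVector_of_ne (hD : IsLatticeDomain μ Γ D) {γ γ' : Γ} (h : γ ≠ γ') (z : G) :
    ⟪hD.blockVector γ z, hD.blockVector γ' z⟫_ℂ = 0 := by
  have hdisj : Disjoint (blockSet D γ z) (blockSet D γ' z) :=
    ((hD.pairwise_disjoint_tile h).preimage _).mono Set.inter_subset_right Set.inter_subset_right
  simp [inner_blockVector, hdisj.inter_eq]

theorem inner_blockVector_indicator (hD : IsLatticeDomain μ Γ D) (γ : Γ) (z : G) :
    ⟪hD.blockVector γ z, indicatorConstLp 2 hD.measurableSet hD.measure_ne_top (1 : ℂ)⟫_ℂ =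
      ⟪hD.blockVector γ z, hD.blockVector γ z⟫_ℂ := by
  have hsub : blockSet D γ z ⊆ D := Set.inter_subset_left
  rw [inner_blockVector, Set.inter_self, blockVector,
    L2.inner_indicatorConstLp_one_indicatorConstLp_one (hD.measurableSet_blockSet γ z)
      hD.measurableSet (hD.measure_blockSet_ne_top γ z) hD.measure_ne_top,
    Set.inter_eq_left.2 hsub]
  rfl

end IsLatticeDomain

end LatticeDomains

section BlockOperators

variable {G : Type u} [Group G] [MeasurableSpace G] {μ : Measure G} {Γ : Subgroup G} {D : Set G}
  {ι : Type*} (b : HilbertBasis ι ℂ (Lp ℂ 2 μ))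

namespace IsLatticeDomain

theorem isBoundedColumn_indicator (hD : IsLatticeDomain μ Γ D) :
    IsBoundedColumn (fun m (_ : G) =>
      ⟪b m, indicatorConstLp 2 hD.measurableSet hD.measure_ne_top (1 : ℂ)⟫_ℂ)
      (‖indicatorConstLp 2 hD.measurableSet hD.measure_ne_top (1 : ℂ)‖ ^ 2) :=
  ⟨fun _ => measurable_const, fun _ => sum_norm_inner_sq_le b _⟩

/-- The embedding of `ξ` as the function `(z, q) ↦ ξ(z)` on `G × D`, expanded in `q` along the
basis `b`. -/
def domainOp (hD : IsLatticeDomain μ Γ D) : Lp ℂ 2 μ →L[ℂ] ℓ²(ι, Lp ℂ 2 μ) :=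
  (hD.isBoundedColumn_indicator b).columnOp μ

theorem inner_domainOp [Countable ι] (hD : IsLatticeDomain μ Γ D) (T : Lp ℂ 2 μ →L[ℂ] Lp ℂ 2 μ)
    (ξ η : Lp ℂ 2 μ) :
    ⟪hD.domainOp b η, diagOp ι T (hD.domainOp b ξ)⟫_ℂ = μ.real D * ⟪η, T ξ⟫_ℂ := by
  rw [domainOp, IsBoundedColumn.diagOp_columnOp_const, IsBoundedColumn.inner_columnOp_of_const _ _
    fun _ => hasSum_conj_inner_mul_inner b _ _, L2.inner_indicatorConstLp_one_indicatorConstLp_one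
      hD.measurableSet hD.measurableSet hD.measure_ne_top hD.measure_ne_top, Set.inter_self]
  rfl

theorem norm_domainOp_sq [Countable ι] (hD : IsLatticeDomain μ Γ D) (ξ : Lp ℂ 2 μ) :
    ‖hD.domainOp b ξ‖ ^ 2 = μ.real D * ‖ξ‖ ^ 2 := by
  have h := hD.inner_domainOp b (.id ℂ _) ξ ξ
  change ⟪hD.domainOp b ξ, hD.domainOp b ξ⟫_ℂ = _ * ⟪ξ, ξ⟫_ℂ at h
  simp only [inner_self_eq_norm_sq_to_K, Complex.coe_algebraMap] at h
  exact_mod_cast h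

variable [MeasurableMul₂ G] [SFinite μ]

theorem measurable_inner_blockVector (hD : IsLatticeDomain μ Γ D) (v : Lp ℂ 2 μ) (γ : Γ) :
    Measurable fun z => ⟪v, hD.blockVector γ z⟫_ℂ := by
  let B : Set (G × G) := {p | p.2 ∈ D ∧ p.1 * p.2 * (γ : G)⁻¹ ∈ D}
  have hB : MeasurableSet B := (hD.measurableSet.preimage measurable_snd).inter
    (hD.measurableSet.preimage ((measurable_fst.mul measurable_snd).mul_const _))
  have hmeas : StronglyMeasurable fun z => ∫ q, B.indicator (fun p => v p.2) (z, q) ∂μ :=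
    (((Lp.stronglyMeasurable v).comp_measurable measurable_snd).indicator hB).integral_prod_right'
  have hinner : ∀ z, ⟪v, hD.blockVector γ z⟫_ℂ =
      starRingEnd ℂ (∫ q, B.indicator (fun p => v p.2) (z, q) ∂μ) := fun z => by
    rw [← inner_conj_symm, blockVector, L2.inner_indicatorConstLp_one,
      ← integral_indicator (hD.measurableSet_blockSet γ z)]
    rfl
  simp only [hinner]
  exact Complex.continuous_conj.measurable.comp hmeas.measurable

theorem isBoundedColumn_block (hD : IsLatticeDomain μ Γ D) (γ : Γ) :
    IsBoundedColumn (fun m z => ⟪b m, hD.blockVector γ z⟫_ℂ) (μ.real D) where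
  measurable m := hD.measurable_inner_blockVector (b m) γ
  sum_sq_le z s := (sum_norm_inner_sq_le b _ s).trans <| by
    rw [norm_blockVector_sq]
    exact measureReal_mono Set.inter_subset_left hD.measure_ne_top

/-- The component at the tile `D γ` of the field `q ↦ ξ(· q⁻¹)` on `D`, in coordinates: it is the
function `(z, q) ↦ ξ(z)` on `{(z, q) | q ∈ D, z q ∈ D γ}`, expanded in `q` along the basis `b`. -/
def blockOp (hD : IsLatticeDomain μ Γ D) (γ : Γ) : Lp ℂ 2 μ →L[ℂ] ℓ²(ι, Lp ℂ 2 μ) :=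
  (hD.isBoundedColumn_block b γ).columnOp μ

theorem isBlockFamily_blockOp [Countable ι] (hD : IsLatticeDomain μ Γ D) (ξ : Lp ℂ 2 μ) :
    IsBlockFamily ℂ (hD.domainOp b ξ) fun γ => hD.blockOp b γ ξ where
  orthogonal γ γ' h := by
    refine (IsBoundedColumn.inner_columnOp_of_const _ _ (fun z => ?_) ξ ξ).trans (zero_mul _)
    exact hD.inner_blockVector_of_ne h z ▸ hasSum_conj_inner_mul_inner b _ _
  inner_left γ := by
    rw [RCLike.ofReal_pow]
    refine Eq.trans ?_ (inner_self_eq_norm_sq_to_K (𝕜 := ℂ) (hD.blockOp b γ ξ))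
    rw [blockOp, domainOp, IsBoundedColumn.inner_columnOp _ _
        fun z => hasSum_conj_inner_mul_inner b (hD.blockVector γ z) _,
      IsBoundedColumn.inner_columnOp _ _
        fun z => hasSum_conj_inner_mul_inner b (hD.blockVector γ z) _]
    simp only [inner_blockVector_indicator]

variable [Countable Γ]

theorem isBoundedColumn_blocks (hD : IsLatticeDomain μ Γ D) (σ : Γ) :
    IsBoundedColumn (fun (p : Γ × ι) z => ⟪b p.2, hD.blockVector (σ * p.1) z⟫_ℂ) (μ.real D) where
  measurable p := hD.measurable_inner_blockVector (b p.2) (σ * p.1)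
  sum_sq_le z s := by
    have hsum := hasSum_prod_norm_inner_sq b (x := fun γ => hD.blockVector (σ * γ) z)
      (hD.hasSum_norm_blockVector_sq σ z)
    exact sum_le_hasSum s (fun _ _ => by positivity) hsum

/-- The operators `blockOp b (σ * γ)`, for all `γ`, collected in one Hilbert sum. -/
def blocksOp (hD : IsLatticeDomain μ Γ D) (σ : Γ) : Lp ℂ 2 μ →L[ℂ] ℓ²(Γ × ι, Lp ℂ 2 μ) :=
  (hD.isBoundedColumn_blocks b σ).columnOp μ

theorem norm_blocksOp_sq [Countable ι] (hD : IsLatticeDomain μ Γ D) (σ : Γ) (ξ : Lp ℂ 2 μ) :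
    ‖hD.blocksOp b σ ξ‖ ^ 2 = μ.real D * ‖ξ‖ ^ 2 := by
  have hw : ∀ z, HasSum (fun p : Γ × ι =>
      starRingEnd ℂ ⟪b p.2, hD.blockVector (σ * p.1) z⟫_ℂ *
        ⟪b p.2, hD.blockVector (σ * p.1) z⟫_ℂ) (μ.real D : ℂ) := fun z => by
    have hsum := hD.hasSum_norm_blockVector_sq σ z
    refine hasSum_prod_conj_inner_mul_inner b (x := fun γ => hD.blockVector (σ * γ) z)
      (y := fun γ => hD.blockVector (σ * γ) z) hsum.summable hsum.summable ?_
    simpa only [inner_self_eq_norm_sq_to_K, Complex.coe_algebraMap, Complex.ofReal_pow] using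
      Complex.hasSum_ofReal.2 hsum
  have h := IsBoundedColumn.inner_columnOp_of_const (hD.isBoundedColumn_blocks b σ)
    (hD.isBoundedColumn_blocks b σ) hw ξ ξ
  simp only [inner_self_eq_norm_sq_to_K, Complex.coe_algebraMap] at h
  exact_mod_cast h

theorem hasSum_norm_blockOp_sq [Countable ι] (hD : IsLatticeDomain μ Γ D)
    (ξ : Lp ℂ 2 μ) :
    HasSum (fun γ => ‖hD.blockOp b γ ξ‖ ^ 2) (‖hD.domainOp b ξ‖ ^ 2) := by
  rw [norm_domainOp_sq, ← norm_blocksOp_sq b hD 1]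
  have hsum : HasSum (fun γ => ‖hD.blockOp b (1 * γ) ξ‖ ^ 2) (‖hD.blocksOp b 1 ξ‖ ^ 2) :=
    (hasSum_norm_sq_lp (hD.blocksOp b 1 ξ)).prod_fiberwise fun γ =>
      hasSum_norm_sq_lp (hD.blockOp b (1 * γ) ξ)
  simpa only [one_mul] using hsum

theorem sliceOp_blocksOp_leftRegular [Countable ι] [μ.IsMulLeftInvariant]
    (hD : IsLatticeDomain μ Γ D) (σ : Γ) (x : G) :
    sliceOp (hD.blocksOp b 1) (hD.blocksOp b σ) (leftRegular μ x) =
      (μ.real (tile D σ ∩ (fun q => x⁻¹ * q) ⁻¹' D) : ℂ) • leftRegular μ x := by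
  have hw : ∀ z, HasSum (fun p : Γ × ι =>
      starRingEnd ℂ ⟪b p.2, hD.blockVector (σ * p.1) z⟫_ℂ *
        ⟪b p.2, hD.blockVector (1 * p.1) (x⁻¹ * z)⟫_ℂ)
      (μ.real (tile D σ ∩ (fun q => x⁻¹ * q) ⁻¹' D) : ℂ) := fun z => by
    refine hasSum_prod_conj_inner_mul_inner b (x := fun γ => hD.blockVector (σ * γ) z)
      (y := fun γ => hD.blockVector (1 * γ) (x⁻¹ * z))
      (hD.hasSum_norm_blockVector_sq σ z).summable
      (hD.hasSum_norm_blockVector_sq 1 (x⁻¹ * z)).summable ?_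
    simpa only [one_mul] using hD.hasSum_inner_blockVector σ x z
  exact IsBoundedColumn.sliceOp_columnOp_leftRegular (hD.isBoundedColumn_blocks b 1)
    (hD.isBoundedColumn_blocks b σ) hw

theorem hasSum_inner_blockOp (hD : IsLatticeDomain μ Γ D) (T : Lp ℂ 2 μ →L[ℂ] Lp ℂ 2 μ)
    (σ : Γ) (ξ η : Lp ℂ 2 μ) :
    HasSum (fun γ => ⟪hD.blockOp b (σ * γ) η, diagOp ι T (hD.blockOp b γ ξ)⟫_ℂ)
      ⟪η, sliceOp (hD.blocksOp b 1) (hD.blocksOp b σ) T ξ⟫_ℂ := by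
  have hsum := (hasSum_inner_sliceOp (hD.blocksOp b 1) (hD.blocksOp b σ) T ξ η).prod_fiberwise
    fun γ => lp.hasSum_inner (𝕜 := ℂ) (hD.blockOp b (σ * γ) η)
      (diagOp ι T (hD.blockOp b (1 * γ) ξ))
  simpa only [one_mul] using hsum

end IsLatticeDomain

end BlockOperators

section Limits

theorem IsBlockFamily.hasSum {𝕜 E ι : Type*} [RCLike 𝕜] [NormedAddCommGroup E]
    [InnerProductSpace 𝕜 E] {ξ : E} {x : ι → E} (h : IsBlockFamily 𝕜 ξ x)
    (hsum : HasSum (fun i => ‖x i‖ ^ 2) (‖ξ‖ ^ 2)) : HasSum x ξ := by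
  have hlim : Tendsto (fun A : Finset ι => √(‖ξ‖ ^ 2 - ∑ i ∈ A, ‖x i‖ ^ 2)) atTop (𝓝 0) := by
    have h0 := (Tendsto.const_sub (‖ξ‖ ^ 2) hsum).sqrt
    rwa [sub_self, Real.sqrt_zero] at h0
  refine tendsto_iff_norm_sub_tendsto_zero.2 (hlim.congr fun A => ?_)
  rw [← h.norm_sub_sum_sq, Real.sqrt_sq (norm_nonneg _), norm_sub_rev]

namespace HerzSchurBound

variable {Λ E : Type*} [Group Λ] [NormedAddCommGroup E] [InnerProductSpace ℂ E] {ξ η : E}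
  {x y : Λ → E} {k : ℝ}

theorem norm_le_of_hasSum {φ : Λ → ℂ} (h : HerzSchurBound φ k) (hk : 0 ≤ k) (T : E →L[ℂ] E)
    (hx : IsBlockFamily ℂ ξ x) (hy : IsBlockFamily ℂ η y) {F : Finset Λ}
    (hF : ∀ i, φ i ≠ 0 → i ∈ F) {w : ℂ}
    (hw : HasSum (fun j => ∑ σ ∈ F, φ σ * ⟪y (σ * j), T (x j)⟫_ℂ) w) :
    ‖w‖ ≤ k * ‖T‖ * (‖ξ‖ * ‖η‖) :=
  le_of_tendsto (Tendsto.norm hw) (Eventually.of_forall (h.norm_sum_support_le hk T hx hy hF))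

theorem eventually_norm_sub_le_of_hasSum {β : Type*} {l : Filter β} {φ : β → Λ → ℂ}
    (h : ∀ a, HerzSchurBound (φ a) k) (hk : 0 ≤ k) {F : β → Finset Λ}
    (hF : ∀ a i, φ a i ≠ 0 → i ∈ F a) (hlim : ∀ i, Tendsto (fun a => φ a i) l (𝓝 1))
    (hx : IsBlockFamily ℂ ξ x) (hy : IsBlockFamily ℂ η y) (hxξ : HasSum x ξ) (hyη : HasSum y η)
    {ε : ℝ} (hε : 0 < ε) :
    ∀ᶠ a in l, ∀ (T : E →L[ℂ] E) (w : ℂ),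
      HasSum (fun j => ∑ σ ∈ F a, φ a σ * ⟪y (σ * j), T (x j)⟫_ℂ) w →
        ‖w - ⟪η, T ξ⟫_ℂ‖ ≤ ε * ‖T‖ := by
  have htail : Tendsto (fun A : Finset Λ =>
      (k + 1) * (‖ξ - ∑ j ∈ A, x j‖ * ‖η‖ + ‖ξ‖ * ‖η - ∑ j ∈ A, y j‖)) atTop (𝓝 0) := by
    simpa using ((((hxξ.const_sub ξ).norm.mul_const ‖η‖).add
      ((hyη.const_sub η).norm.const_mul ‖ξ‖)).const_mul (k + 1))
  obtain ⟨A, hA⟩ := (htail.eventually_lt_const (half_pos hε)).exists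
  let M : ℝ := (A.card : ℝ) ^ 2 * (‖ξ‖ * ‖η‖)
  have hM : 0 < M + 1 := by positivity
  have hclose : ∀ᶠ a in l, ∀ i ∈ A, ∀ j ∈ A, ‖φ a (i * j⁻¹) - 1‖ ≤ ε / 2 / (M + 1) := by
    refine A.eventually_all.2 fun i _ => A.eventually_all.2 fun j _ => ?_
    exact (tendsto_iff_norm_sub_tendsto_zero.1 (hlim (i * j⁻¹))).eventually_le_const (by positivity)
  have hsquare : (A.card : ℝ) ^ 2 * (ε / 2 / (M + 1)) * (‖ξ‖ * ‖η‖) ≤ ε / 2 := by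
    calc _ = M * (ε / 2) / (M + 1) := by ring
      _ ≤ ε / 2 := (div_le_iff₀ hM).2 (by linarith)
  filter_upwards [hclose] with a ha T w hw
  refine le_of_tendsto (hw.sub_const ⟪η, T ξ⟫_ℂ).norm <|
    (eventually_ge_atTop A).mono fun B hB =>
      ((h a).norm_sum_support_sub_le hk T hx hy (hF a) hB ha).trans ?_
  rw [mul_comm]
  gcongr
  linarith

end HerzSchurBound

theorem HasFiniteHerzSchurApproximation.exists_tendsto {Λ : Type*} [Group Λ] {k : ℝ}
    (h : HasFiniteHerzSchurApproximation Λ k) :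
    ∃ (ψ : Finset Λ × ℕ → Λ → ℂ) (F : Finset Λ × ℕ → Finset Λ),
      (∀ α i, ψ α i ≠ 0 → i ∈ F α) ∧ (∀ α, HerzSchurBound (ψ α) k) ∧
        ∀ i, Tendsto (fun α => ψ α i) atTop (𝓝 1) := by
  classical
  choose ψ hfin hψ hψ1 using fun α : Finset Λ × ℕ =>
    h α.1 (1 / ((α.2 : ℝ) + 1)) Nat.one_div_pos_of_nat
  refine ⟨ψ, fun α => (hfin α).toFinset, fun α i hi => (hfin α).mem_toFinset.2 hi, hψ, fun i => ?_⟩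
  have hlim : Tendsto (fun α : Finset Λ × ℕ => 1 / ((α.2 : ℝ) + 1)) atTop (𝓝 0) := by
    rw [← prod_atTop_atTop_eq]
    exact tendsto_one_div_add_atTop_nhds_zero_nat.comp tendsto_snd
  refine tendsto_iff_norm_sub_tendsto_zero.2 (squeeze_zero' (Eventually.of_forall fun _ =>
    norm_nonneg _) ?_ hlim)
  filter_upwards [eventually_ge_atTop ({i}, 0)] with α hα
  exact (hψ1 α i (Finset.singleton_subset_iff.1 hα.1)).le

end Limits

section FiniteSums

variable {ι H : Type*} [NormedAddCommGroup H] [InnerProductSpace ℂ H] {n : ℕ}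

/-- The canonical map from the sum of `n` copies of `ℓ²(ι, H)` to the Hilbert sum of copies of
`Hⁿ`. -/
def lpPi (f : Fin n → ℓ²(ι, H)) : ℓ²(ι, PiLp 2 fun _ : Fin n => H) :=
  ⟨fun m => WithLp.toLp 2 fun i => f i m, memℓp_two_of_summable <| by
    simpa only [PiLp.norm_sq_eq_of_L2] using
      summable_sum fun i _ => (hasSum_norm_sq_lp (f i)).summable⟩

theorem inner_lpPi (f g : Fin n → ℓ²(ι, H)) : ⟪lpPi f, lpPi g⟫_ℂ = ∑ i, ⟪f i, g i⟫_ℂ :=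
  (lp.hasSum_inner (𝕜 := ℂ) (lpPi f) (lpPi g)).unique <|
    (hasSum_sum fun i _ => lp.hasSum_inner (𝕜 := ℂ) (f i) (g i)).congr_fun fun _ =>
      PiLp.inner_apply _ _

theorem norm_lpPi_sq (f : Fin n → ℓ²(ι, H)) : ‖lpPi f‖ ^ 2 = ∑ i, ‖f i‖ ^ 2 := by
  have h := inner_lpPi f f
  simp only [inner_self_eq_norm_sq_to_K, Complex.coe_algebraMap] at h
  exact_mod_cast h

theorem isBlockFamily_lpPi {Λ : Type*} {ξ : Fin n → ℓ²(ι, H)} {x : Fin n → Λ → ℓ²(ι, H)}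
    (h : ∀ i, IsBlockFamily ℂ (ξ i) (x i)) :
    IsBlockFamily ℂ (lpPi ξ) fun j => lpPi fun i => x i j where
  orthogonal j j' hj :=
    (inner_lpPi _ _).trans (Finset.sum_eq_zero fun i _ => (h i).orthogonal hj)
  inner_left j := by
    rw [inner_lpPi, norm_lpPi_sq, RCLike.ofReal_sum]
    exact Finset.sum_congr rfl fun i _ => (h i).inner_left j

theorem inner_lpPi_diagOp_matrixOperator {G : Type u} [Group G] [MeasurableSpace G]
    [MeasurableMul G] {μ : Measure G} [μ.IsMulLeftInvariant]
    (a : Matrix (Fin n) (Fin n) (GroupVN μ)) (f g : Fin n → ℓ²(ι, Lp ℂ 2 μ)) :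
    ⟪lpPi g, diagOp ι (matrixOperator a) (lpPi f)⟫_ℂ =
      ∑ i, ∑ j, ⟪g i, diagOp ι (a i j).1 (f j)⟫_ℂ :=
  (lp.hasSum_inner (𝕜 := ℂ) (lpPi g) (diagOp ι (matrixOperator a) (lpPi f))).unique <|
    (hasSum_sum fun i _ => hasSum_sum fun j _ =>
      lp.hasSum_inner (𝕜 := ℂ) (g i) (diagOp ι (a i j).1 (f j))).congr_fun fun _ =>
        inner_matrixOperator a _ _

end FiniteSums

section InducedMultipliers

variable {G : Type u} [Group G] [MeasurableSpace G] {μ : Measure G} {Γ : Subgroup G} {D : Set G}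

/-- The function on `G` induced by the function `ψ` on `Γ` with support in `F`: its value at `x` is
the integral of `ψ` along the cocycle `D → Γ` of `x`, with respect to the normalized measure
on `D`. -/
def inducedFunction (μ : Measure G) (D : Set G) (ψ : Γ → ℂ) (F : Finset Γ) : G → ℂ :=
  ((μ.real D)⁻¹ : ℂ) • ∑ σ ∈ F, ψ σ • fun x =>
    (μ.real (tile D σ ∩ (fun q => x⁻¹ * q) ⁻¹' D) : ℂ)

namespace IsLatticeDomain

theorem norm_domainOp {ι : Type*} [Countable ι] (b : HilbertBasis ι ℂ (Lp ℂ 2 μ))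
    (hD : IsLatticeDomain μ Γ D) (ξ : Lp ℂ 2 μ) :
    ‖hD.domainOp b ξ‖ = √(μ.real D) * ‖ξ‖ := by
  rw [← Real.sqrt_sq (norm_nonneg _), norm_domainOp_sq, Real.sqrt_mul measureReal_nonneg,
    Real.sqrt_sq (norm_nonneg _)]

variable [MeasurableMul₂ G] [SFinite μ] [Countable Γ] {ι : Type*}
  [Countable ι] (b : HilbertBasis ι ℂ (Lp ℂ 2 μ))

theorem hasSum_blockOp (hD : IsLatticeDomain μ Γ D) (ξ : Lp ℂ 2 μ) :
    HasSum (fun γ => hD.blockOp b γ ξ) (hD.domainOp b ξ) :=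
  (hD.isBlockFamily_blockOp b ξ).hasSum (hD.hasSum_norm_blockOp_sq b ξ)

variable [μ.IsMulLeftInvariant]

/-- The operator on the group von Neumann algebra with symbol `inducedFunction μ D ψ F`. -/
def inducedMap (hD : IsLatticeDomain μ Γ D) (ψ : Γ → ℂ) (F : Finset Γ) :
    GroupVN μ →L[ℂ] GroupVN μ :=
  ((μ.real D)⁻¹ : ℂ) • ∑ σ ∈ F, ψ σ •
    sliceVN (hD.blocksOp b 1) (hD.blocksOp b σ) (hD.sliceOp_blocksOp_leftRegular b σ)

variable {k : ℝ} {ψ : Γ → ℂ} {F : Finset Γ}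

theorem isNormalMultiplierMap_inducedMap (hD : IsLatticeDomain μ Γ D) (ψ : Γ → ℂ)
    (F : Finset Γ) : IsNormalMultiplierMap (inducedFunction μ D ψ F) (hD.inducedMap b ψ F) :=
  (IsNormalMultiplierMap.sum F fun σ =>
    (isNormalMultiplierMap_sliceVN (hD.sliceOp_blocksOp_leftRegular b σ)).smul (ψ σ)).smul _

theorem hasSum_inner_inducedMap (hD : IsLatticeDomain μ Γ D) (ψ : Γ → ℂ) (F : Finset Γ)
    (T : GroupVN μ) (ξ η : Lp ℂ 2 μ) :
    HasSum (fun γ => ∑ σ ∈ F,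
        ψ σ * ⟪hD.blockOp b (σ * γ) η, diagOp ι T.1 (hD.blockOp b γ ξ)⟫_ℂ)
      (μ.real D * ⟪η, (hD.inducedMap b ψ F T).1 ξ⟫_ℂ) := by
  have hne : (μ.real D : ℂ) ≠ 0 := Complex.ofReal_ne_zero.2 hD.measureReal_pos.ne'
  have hmap : μ.real D * ⟪η, (hD.inducedMap b ψ F T).1 ξ⟫_ℂ =
      ∑ σ ∈ F, ψ σ * ⟪η, sliceOp (hD.blocksOp b 1) (hD.blocksOp b σ) T.1 ξ⟫_ℂ := by
    have hvector : (hD.inducedMap b ψ F T).1 ξ = ((μ.real D)⁻¹ : ℂ) • ∑ σ ∈ F, ψ σ •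
        sliceOp (hD.blocksOp b 1) (hD.blocksOp b σ) T.1 ξ := by
      simp [inducedMap, coe_sliceVN]
    rw [hvector, inner_smul_right, mul_inv_cancel_left₀ hne, inner_sum]
    simp only [inner_smul_right]
  rw [hmap]
  exact hasSum_sum fun σ _ => (hD.hasSum_inner_blockOp b T.1 σ ξ η).mul_left (ψ σ)

theorem norm_inner_inducedMap_le (hD : IsLatticeDomain μ Γ D) (hk : 0 ≤ k)
    (hψ : HerzSchurBound ψ k) (hF : ∀ i, ψ i ≠ 0 → i ∈ F) (T : GroupVN μ) (ξ η : Lp ℂ 2 μ) :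
    ‖⟪η, (hD.inducedMap b ψ F T).1 ξ⟫_ℂ‖ ≤ k * ‖T‖ * (‖ξ‖ * ‖η‖) := by
  have hbound := hψ.norm_le_of_hasSum hk (diagOp ι T.1) (hD.isBlockFamily_blockOp b ξ)
    (hD.isBlockFamily_blockOp b η) hF (hD.hasSum_inner_inducedMap b ψ F T ξ η)
  rw [norm_mul, Complex.norm_of_nonneg measureReal_nonneg, norm_domainOp, norm_domainOp] at hbound
  refine le_of_mul_le_mul_left (hbound.trans ?_) hD.measureReal_pos
  calc k * ‖diagOp ι T.1‖ * (√(μ.real D) * ‖ξ‖ * (√(μ.real D) * ‖η‖))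
      ≤ k * ‖T.1‖ * (√(μ.real D) * ‖ξ‖ * (√(μ.real D) * ‖η‖)) := by
        gcongr
        exact norm_diagOp_le T.1
    _ = √(μ.real D) * √(μ.real D) * (k * ‖T.1‖ * (‖ξ‖ * ‖η‖)) := by ring
    _ = μ.real D * (k * ‖T‖ * (‖ξ‖ * ‖η‖)) := by rw [Real.mul_self_sqrt measureReal_nonneg]; rfl

theorem norm_matrixOperator_map_inducedMap_le (hD : IsLatticeDomain μ Γ D) (hk : 0 ≤ k)
    (hψ : HerzSchurBound ψ k) (hF : ∀ i, ψ i ≠ 0 → i ∈ F) {n : ℕ}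
    (a : Matrix (Fin n) (Fin n) (GroupVN μ)) :
    ‖matrixOperator (a.map (hD.inducedMap b ψ F))‖ ≤ k * ‖matrixOperator a‖ := by
  refine ContinuousLinearMap.opNorm_le_of_re_inner_le (by positivity) fun ξ η hξ hη => ?_
  have hnorm : ∀ ζ : PiLp 2 fun _ : Fin n => Lp ℂ 2 μ, ‖ζ‖ = 1 →
      ‖lpPi fun i => hD.domainOp b (ζ i)‖ = √(μ.real D) := fun ζ hζ => by
    have hsq := PiLp.norm_sq_eq_of_L2 _ ζ
    rw [← Real.sqrt_sq (norm_nonneg _), norm_lpPi_sq]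
    simp only [norm_domainOp_sq]
    rw [← Finset.mul_sum, ← hsq, hζ, one_pow, mul_one]
  have hsum : HasSum (fun γ => ∑ σ ∈ F, ψ σ * ⟪lpPi fun i => hD.blockOp b (σ * γ) (η i),
      diagOp ι (matrixOperator a) (lpPi fun i => hD.blockOp b γ (ξ i))⟫_ℂ)
      (μ.real D * ⟪η, matrixOperator (a.map (hD.inducedMap b ψ F)) ξ⟫_ℂ) := by
    rw [inner_matrixOperator]
    simp only [inner_lpPi_diagOp_matrixOperator, Finset.mul_sum]
    refine (hasSum_sum fun i _ => hasSum_sum fun j _ =>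
      hD.hasSum_inner_inducedMap b ψ F (a i j) (ξ j) (η i)).congr_fun fun γ => ?_
    rw [Finset.sum_comm]
    exact Finset.sum_congr rfl fun i _ => Finset.sum_comm
  have hbound := hψ.norm_le_of_hasSum hk (diagOp ι (matrixOperator a))
    (isBlockFamily_lpPi fun i => hD.isBlockFamily_blockOp b (ξ i))
    (isBlockFamily_lpPi fun i => hD.isBlockFamily_blockOp b (η i)) hF hsum
  rw [hnorm ξ hξ, hnorm η hη, Real.mul_self_sqrt measureReal_nonneg, norm_mul,
    Complex.norm_of_nonneg measureReal_nonneg, mul_comm] at hbound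
  rw [inner_re_symm]
  exact (RCLike.re_le_norm _).trans <| (le_of_mul_le_mul_right hbound hD.measureReal_pos).trans
    (by gcongr; exact norm_diagOp_le _)

theorem cbNorm_inducedMap_le (hD : IsLatticeDomain μ Γ D) (hk : 0 ≤ k)
    (hψ : HerzSchurBound ψ k) (hF : ∀ i, ψ i ≠ 0 → i ∈ F) :
    cbNorm (hD.inducedMap b ψ F : GroupVN μ →ₗ[ℂ] GroupVN μ) ≤ ENNReal.ofReal k := by
  refine iSup_le fun n => iSup₂_le fun a ha => ?_
  rw [← ofReal_norm]
  exact ENNReal.ofReal_le_ofReal <|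
    (hD.norm_matrixOperator_map_inducedMap_le b hk hψ hF a).trans (mul_le_of_le_one_right hk ha)

end IsLatticeDomain

end InducedMultipliers

section Convergence

variable {G : Type u} [Group G] [MeasurableSpace G] {μ : Measure G}

theorem norm_vectorFunctional_comp_le [MeasurableMul G] [μ.IsMulLeftInvariant]
    {S : GroupVN μ →L[ℂ] GroupVN μ} {C : ℝ} (hC : 0 ≤ C) {f g : Lp ℂ 2 μ}
    (h : ∀ T, ‖⟪g, (S T).1 f⟫_ℂ‖ ≤ C * ‖T‖ * (‖f‖ * ‖g‖)) :
    ‖vectorFunctional f g ∘L S‖ ≤ C * (‖f‖ * ‖g‖) :=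
  ContinuousLinearMap.opNorm_le_bound _ (by positivity) fun T => (h T).trans_eq (by ring)

theorem IsNormalFunctional.exists_hasSum_vectorFunctional [MeasurableMul G] [μ.IsMulLeftInvariant]
    {ω : GroupVN μ →L[ℂ] ℂ} (hω : IsNormalFunctional ω) :
    ∃ f g : ℕ → Lp ℂ 2 μ, (Summable fun n => ‖f n‖ * ‖g n‖) ∧
      HasSum (fun n => vectorFunctional (f n) (g n)) ω := by
  obtain ⟨f, g, hf, hg, hω⟩ := hω
  have hfg := summable_norm_mul_norm hf hg
  have hsummable : Summable fun n => vectorFunctional (f n) (g n) :=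
    .of_norm_bounded hfg fun n => ContinuousLinearMap.opNorm_le_bound _ (by positivity) fun T =>
      (norm_inner_apply_le T.1 (f n) (g n)).trans_eq (mul_comm _ _)
  refine ⟨f, g, hfg, ?_⟩
  have hlim : ∑' n, vectorFunctional (f n) (g n) = ω := ContinuousLinearMap.ext fun T =>
    (hsummable.hasSum.mapL (ContinuousLinearMap.apply ℂ ℂ T)).unique (hω T)
  exact hlim ▸ hsummable.hasSum

namespace IsLatticeDomain

variable [MeasurableMul₂ G] [SFinite μ] [μ.IsMulLeftInvariant] {Γ : Subgroup G} {D : Set G}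
  [Countable Γ] {ι : Type*} [Countable ι] (b : HilbertBasis ι ℂ (Lp ℂ 2 μ)) {k : ℝ}
  {β : Type*} {l : Filter β} {ψ : β → Γ → ℂ} {F : β → Finset Γ}

theorem tendsto_vectorFunctional_comp_inducedMap (hD : IsLatticeDomain μ Γ D) (hk : 0 ≤ k)
    (hψ : ∀ a, HerzSchurBound (ψ a) k) (hF : ∀ a i, ψ a i ≠ 0 → i ∈ F a)
    (hlim : ∀ i, Tendsto (fun a => ψ a i) l (𝓝 1)) (f g : Lp ℂ 2 μ) :
    Tendsto (fun a => vectorFunctional f g ∘L hD.inducedMap b (ψ a) (F a)) l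
      (𝓝 (vectorFunctional f g)) := by
  refine Metric.tendsto_nhds.2 fun ε hε => ?_
  have hpos := hD.measureReal_pos
  filter_upwards [HerzSchurBound.eventually_norm_sub_le_of_hasSum hψ hk hF hlim
    (hD.isBlockFamily_blockOp b f) (hD.isBlockFamily_blockOp b g) (hD.hasSum_blockOp b f)
    (hD.hasSum_blockOp b g) (mul_pos hpos (half_pos hε))] with a ha
  rw [dist_eq_norm]
  refine (ContinuousLinearMap.opNorm_le_bound _ (half_pos hε).le fun T => ?_).trans_lt
    (half_lt_self hε)
  have hT := ha (diagOp ι T.1) _ (hD.hasSum_inner_inducedMap b (ψ a) (F a) T f g)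
  rw [inner_domainOp, ← mul_sub, norm_mul, Complex.norm_of_nonneg hpos.le, mul_assoc] at hT
  refine (le_of_mul_le_mul_left hT hpos).trans ?_
  gcongr
  exact norm_diagOp_le T.1

theorem tendsto_comp_inducedMap (hD : IsLatticeDomain μ Γ D) (hk : 0 ≤ k)
    (hψ : ∀ a, HerzSchurBound (ψ a) k) (hF : ∀ a i, ψ a i ≠ 0 → i ∈ F a)
    (hlim : ∀ i, Tendsto (fun a => ψ a i) l (𝓝 1)) {ω : GroupVN μ →L[ℂ] ℂ}
    (hω : IsNormalFunctional ω) :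
    Tendsto (fun a => ω ∘L hD.inducedMap b (ψ a) (F a)) l (𝓝 ω) := by
  obtain ⟨f, g, hfg, hsum⟩ := hω.exists_hasSum_vectorFunctional
  have hcomp : ∀ S : GroupVN μ →L[ℂ] GroupVN μ,
      HasSum (fun n => vectorFunctional (f n) (g n) ∘L S) (ω ∘L S) := fun S =>
    hsum.mapL ((ContinuousLinearMap.compL ℂ (GroupVN μ) (GroupVN μ) ℂ).flip S)
  have htsum : Tendsto
      (fun a => ∑' n, vectorFunctional (f n) (g n) ∘L hD.inducedMap b (ψ a) (F a)) l
      (𝓝 (∑' n, vectorFunctional (f n) (g n))) :=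
    tendsto_tsum_of_dominated_convergence (hfg.mul_left k)
      (fun n => hD.tendsto_vectorFunctional_comp_inducedMap b hk hψ hF hlim (f n) (g n))
      (Eventually.of_forall fun a n => norm_vectorFunctional_comp_le hk fun T =>
        hD.norm_inner_inducedMap_le b hk (hψ a) (hF a) T (f n) (g n))
  rw [hsum.tsum_eq] at htsum
  exact htsum.congr fun a => (hcomp _).tsum_eq

end IsLatticeDomain

end Convergence

section Coefficients

variable {G : Type u} [Group G] [MeasurableSpace G] {μ : Measure G}

theorem continuous_leftRegular [TopologicalSpace G] [IsTopologicalGroup G]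
    [LocallyCompactSpace G] [BorelSpace G] [μ.IsHaarMeasure] [μ.InnerRegularCompactLTTop]
    (f : Lp ℂ 2 μ) : Continuous fun x => leftRegular μ x f := by
  let g : C(G × G, G) := ⟨fun p => p.1⁻¹ * p.2, by fun_prop⟩
  exact Continuous.compMeasurePreservingLp (f := fun _ : G => f) (g := fun x => g.curry x)
    continuous_const g.curry.continuous (fun x => measurePreserving_mul_left μ x⁻¹) (by simp)

variable [MeasurableMul G] [μ.IsMulLeftInvariant]

theorem inner_indicator_leftRegular_indicator {A B : Set G} (hA : MeasurableSet A)
    (hA' : μ A ≠ ∞) (hB : MeasurableSet B) (hB' : μ B ≠ ∞) (x : G) :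
    ⟪indicatorConstLp 2 hB hB' (1 : ℂ), leftRegular μ x (indicatorConstLp 2 hA hA' (1 : ℂ))⟫_ℂ =
      (μ.real (B ∩ (fun z => x⁻¹ * z) ⁻¹' A) : ℂ) := by
  have hpre : MeasurableSet ((fun z => x⁻¹ * z) ⁻¹' A) := hA.preimage (measurable_const_mul _)
  have htranslate : ∀ᵐ z ∂μ, leftRegular μ x (indicatorConstLp 2 hA hA' (1 : ℂ)) z =
      ((fun z => x⁻¹ * z) ⁻¹' A).indicator (fun _ => (1 : ℂ)) z := by
    filter_upwards [coeFn_leftRegular μ x (indicatorConstLp 2 hA hA' (1 : ℂ)),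
      (measurePreserving_mul_left μ x⁻¹).quasiMeasurePreserving.ae_eq_comp
        (indicatorConstLp_coeFn (p := 2) (hs := hA) (hμs := hA') (c := (1 : ℂ)))] with z hz hz'
    exact hz.trans hz'
  rw [L2.inner_indicatorConstLp_one, integral_congr_ae (ae_restrict_of_ae htranslate),
    integral_indicator hpre, Measure.restrict_restrict hpre, Set.inter_comm]
  simp

theorem sum_inner_leftRegular_mem_fourierAlgebra {ι : Type*} (s : Finset ι) (c : ι → ℂ)
    (f g : ι → Lp ℂ 2 μ) :
    (fun x => ∑ i ∈ s, c i * ⟪g i, leftRegular μ x (f i)⟫_ℂ) ∈ fourierAlgebra μ := by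
  refine ⟨∑ i ∈ s, c i • vectorFunctional (f i) (g i), ?_, fun x => ?_⟩
  · exact Finset.sum_induction _ _ (fun _ _ => IsNormalFunctional.add) .zero fun i _ =>
      (isNormalFunctional_vectorFunctional (f i) (g i)).smul (c i)
  · simp only [sum_apply, smul_apply, smul_eq_mul]
    rfl

theorem tendsto_fourierNorm_sub {β : Type*} {l : Filter β} {ω : GroupVN μ →L[ℂ] ℂ}
    {ω' : β → GroupVN μ →L[ℂ] ℂ} {u : G → ℂ} {v : β → G → ℂ} (hω : Represents ω u)
    (hω' : ∀ a, Represents (ω' a) (v a)) (hlim : Tendsto ω' l (𝓝 ω)) :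
    Tendsto (fun a => fourierNorm μ (v a - u)) l (𝓝 0) := by
  have hrep : ∀ a, Represents (ω' a - ω) (v a - u) := fun a =>
    ⟨(hω' a).1.sub hω.1, fun x => by
      rw [Pi.sub_apply, (hω' a).2 x, hω.2 x, sub_apply]⟩
  have hdist := tendsto_iff_edist_tendsto_0.1 hlim
  exact tendsto_of_tendsto_of_tendsto_of_le_of_le tendsto_const_nhds hdist (fun _ => zero_le)
    fun a => (iInf₂_le (ω' a - ω) (hrep a)).trans_eq (edist_eq_enorm_sub _ _).symm

namespace IsLatticeDomain

variable {Γ : Subgroup G} {D : Set G}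

theorem inducedFunction_eq_sum (hD : IsLatticeDomain μ Γ D) (ψ : Γ → ℂ) (F : Finset Γ) :
    inducedFunction μ D ψ F = fun x => ∑ σ ∈ F, ((μ.real D : ℂ)⁻¹ * ψ σ) *
      ⟪indicatorConstLp 2 (hD.measurableSet_tile σ) ((hD.measure_tile σ).trans_ne hD.measure_ne_top)
        (1 : ℂ), leftRegular μ x (indicatorConstLp 2 hD.measurableSet hD.measure_ne_top 1)⟫_ℂ := by
  funext x
  simp only [inner_indicator_leftRegular_indicator, inducedFunction, Pi.smul_apply,
    Finset.sum_apply, smul_eq_mul, Finset.mul_sum, mul_assoc]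

theorem inducedFunction_mem_fourierAlgebra (hD : IsLatticeDomain μ Γ D) (ψ : Γ → ℂ)
    (F : Finset Γ) : inducedFunction μ D ψ F ∈ fourierAlgebra μ := by
  rw [hD.inducedFunction_eq_sum]
  exact sum_inner_leftRegular_mem_fourierAlgebra _ _ _ _

end IsLatticeDomain

end Coefficients

section Sufficiency

variable {G : Type u} [Group G] [TopologicalSpace G] [IsTopologicalGroup G] [T2Space G]
  [LocallyCompactSpace G] [SecondCountableTopology G] [MeasurableSpace G] [BorelSpace G]
  {μ : Measure G} [μ.IsHaarMeasure] {Γ : Subgroup G} {D : Set G}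

namespace IsLatticeDomain

theorem continuous_inducedFunction (hD : IsLatticeDomain μ Γ D) (ψ : Γ → ℂ)
    (F : Finset Γ) : Continuous (inducedFunction μ D ψ F) := by
  rw [hD.inducedFunction_eq_sum]
  exact continuous_finsetSum _ fun σ _ => continuous_const.mul
    (continuous_const.inner (continuous_leftRegular _))

variable [Countable Γ]

theorem cbMultiplierNorm_inducedFunction_le (hD : IsLatticeDomain μ Γ D) {ψ : Γ → ℂ}
    {F : Finset Γ} {k : ℝ} (hk : 0 ≤ k) (hψ : HerzSchurBound ψ k)
    (hF : ∀ i, ψ i ≠ 0 → i ∈ F) :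
    cbMultiplierNorm μ (inducedFunction μ D ψ F) ≤ ENNReal.ofReal k := by
  have : Fact ((2 : ℝ≥0∞) ≠ ∞) := ⟨ENNReal.ofNat_ne_top⟩
  obtain ⟨w, _, ⟨b⟩⟩ := exists_countable_hilbertBasis (Lp ℂ 2 μ)
  have hS := hD.isNormalMultiplierMap_inducedMap b ψ F
  exact iInf_le_of_le ⟨hD.continuous_inducedFunction ψ F, fun u hu => hS.mul_mem hu⟩ <|
    iInf_le_of_le _ <| iInf_le_of_le hS.isTransposeMultiplier <| hD.cbNorm_inducedMap_le b hk hψ hF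

theorem hasCBApproximateUnit (hD : IsLatticeDomain μ Γ D) {k : ℝ} (hk : 0 ≤ k)
    (h : HasFiniteHerzSchurApproximation Γ k) : HasCBApproximateUnit μ k := by
  classical
  obtain ⟨ψ, F, hF, hψ, hlim⟩ := h.exists_tendsto
  have : Fact ((2 : ℝ≥0∞) ≠ ∞) := ⟨ENNReal.ofNat_ne_top⟩
  obtain ⟨w, _, ⟨b⟩⟩ := exists_countable_hilbertBasis (Lp ℂ 2 μ)
  refine ⟨Finset Γ × ℕ, inferInstance, inferInstance, inferInstance,
    fun α => inducedFunction μ D (ψ α) (F α),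
    fun α => hD.inducedFunction_mem_fourierAlgebra (ψ α) (F α), ?_,
    fun α => hD.cbMultiplierNorm_inducedFunction_le hk (hψ α) (hF α)⟩
  rintro u ⟨ω, hω⟩
  exact tendsto_fourierNorm_sub hω
    (fun α => (hD.isNormalMultiplierMap_inducedMap b (ψ α) (F α)).represents hω)
    (hD.tendsto_comp_inducedMap b hk hψ hF hlim hω.1)

end IsLatticeDomain

end Sufficiency

/-! ### Existence of lattice domains -/

section UnfoldedMeasure

variable {G : Type u} [Group G] [MeasurableSpace G] {Γ : Subgroup G}

/-- The counting measure of the coset `q`, as a measure on `G`. -/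
def cosetMeasure (q : G ⧸ Γ) : Measure G :=
  Measure.sum fun γ : Γ => Measure.dirac (q.out * (γ : G))

theorem cosetMeasure_mk_apply (g : G) {s : Set G} (hs : MeasurableSet s) :
    cosetMeasure (g : G ⧸ Γ) s = ∑' γ : Γ, s.indicator 1 (g * (γ : G)) := by
  obtain ⟨h, hh⟩ := QuotientGroup.mk_out_eq_mul Γ g
  rw [cosetMeasure, Measure.sum_apply _ hs,
    ← (Equiv.mulLeft h).tsum_eq fun γ : Γ => s.indicator 1 (g * (γ : G))]
  simp only [Measure.dirac_apply' _ hs, hh, Equiv.coe_mulLeft, Subgroup.coe_mul, mul_assoc]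

theorem cosetMeasure_smul_apply [MeasurableMul G] (g : G) (q : G ⧸ Γ) {s : Set G}
    (hs : MeasurableSet s) :
    cosetMeasure (g • q) s = cosetMeasure q ((fun x => g * x) ⁻¹' s) := by
  induction q using QuotientGroup.induction_on with | H x => ?_
  rw [MulAction.Quotient.smul_coe, smul_eq_mul, cosetMeasure_mk_apply _ hs,
    cosetMeasure_mk_apply _ (measurable_const_mul g hs)]
  exact tsum_congr fun γ => congrArg (s.indicator 1) (mul_assoc g x γ)

theorem cosetMeasure_preimage_mul_right [MeasurableMul G] (γ : Γ) (q : G ⧸ Γ) {s : Set G}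
    (hs : MeasurableSet s) :
    cosetMeasure q ((fun x => x * (γ : G)) ⁻¹' s) = cosetMeasure q s := by
  induction q using QuotientGroup.induction_on with | H x => ?_
  rw [cosetMeasure_mk_apply _ hs, cosetMeasure_mk_apply _ (measurable_mul_const (γ : G) hs),
    ← (Equiv.mulRight γ).tsum_eq fun γ : Γ => s.indicator 1 (x * (γ : G))]
  exact tsum_congr fun σ => congrArg (s.indicator 1) (mul_assoc x σ γ)

theorem cosetMeasure_le_one {s : Set G} (hs : MeasurableSet s)
    (h : s.InjOn ((↑) : G → G ⧸ Γ)) (q : G ⧸ Γ) : cosetMeasure q s ≤ 1 := by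
  induction q using QuotientGroup.induction_on with | H x => ?_
  rw [cosetMeasure_mk_apply _ hs]
  by_cases hx : ∃ σ : Γ, x * (σ : G) ∈ s
  · obtain ⟨σ, hσ⟩ := hx
    rw [tsum_eq_single σ]
    · exact Set.indicator_le_self' (fun _ _ => zero_le) _
    · refine fun γ hγ => Set.indicator_of_notMem (fun hmem => hγ ?_) _
      exact Subtype.ext <| mul_left_cancel <| h hmem hσ <|
        (QuotientGroup.mk_mul_of_mem x γ.2).trans (QuotientGroup.mk_mul_of_mem x σ.2).symm
  · push Not at hx
    simp [hx]

theorem one_le_cosetMeasure {s : Set G} (hs : MeasurableSet s)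
    (h : s.SurjOn ((↑) : G → G ⧸ Γ) Set.univ) (q : G ⧸ Γ) : 1 ≤ cosetMeasure q s := by
  obtain ⟨x, hx, rfl⟩ := h (Set.mem_univ q)
  rw [cosetMeasure_mk_apply _ hs]
  refine le_trans ?_ (ENNReal.le_tsum (1 : Γ))
  simp [hx]

theorem measurable_cosetMeasure [MeasurableMul G] [Countable Γ] :
    Measurable (cosetMeasure : G ⧸ Γ → Measure G) := by
  refine Measure.measurable_of_measurable_coe _ fun s hs => measurable_from_quotient.2 ?_
  have hmk : ((fun q : G ⧸ Γ => cosetMeasure q s) ∘ Quotient.mk'') =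
      fun g : G => ∑' γ : Γ, s.indicator 1 (g * (γ : G)) :=
    funext fun g => cosetMeasure_mk_apply g hs
  rw [hmk]
  exact Measurable.tsum fun γ => (measurable_one.indicator hs).comp (measurable_mul_const _)

/-- The measure on `G` obtained by integrating the counting measures of the cosets. -/
def unfoldedMeasure (ν : Measure (G ⧸ Γ)) : Measure G := ν.bind cosetMeasure

variable [MeasurableMul G] [Countable Γ] (ν : Measure (G ⧸ Γ))

theorem unfoldedMeasure_apply {s : Set G} (hs : MeasurableSet s) :
    unfoldedMeasure ν s = ∫⁻ q, cosetMeasure q s ∂ν :=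
  Measure.bind_apply hs measurable_cosetMeasure.aemeasurable

theorem isMulLeftInvariant_unfoldedMeasure [SMulInvariantMeasure G (G ⧸ Γ) ν] :
    (unfoldedMeasure ν).IsMulLeftInvariant := by
  refine ⟨fun g => Measure.ext fun s hs => ?_⟩
  have hsmul : MeasurePreserving (fun q : G ⧸ Γ => g • q) ν ν := by
    have hm : Measurable fun q : G ⧸ Γ => g • q :=
      measurable_from_quotient.2 (measurable_quotient_mk''.comp (measurable_const_mul g))
    exact ⟨hm, Measure.ext fun t ht =>
      (Measure.map_apply hm ht).trans (SMulInvariantMeasure.measure_preimage_smul g ht)⟩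
  rw [Measure.map_apply (measurable_const_mul g) hs, unfoldedMeasure_apply _ hs,
    unfoldedMeasure_apply _ (measurable_const_mul g hs)]
  exact (lintegral_congr fun q => (cosetMeasure_smul_apply g q hs).symm).trans
    (hsmul.lintegral_comp ((Measure.measurable_coe hs).comp measurable_cosetMeasure))

theorem measurePreserving_mul_right_unfoldedMeasure (γ : Γ) :
    MeasurePreserving (fun x => x * (γ : G)) (unfoldedMeasure ν) (unfoldedMeasure ν) := by
  refine ⟨measurable_mul_const _, Measure.ext fun s hs => ?_⟩
  rw [Measure.map_apply (measurable_mul_const _) hs, unfoldedMeasure_apply _ hs,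
    unfoldedMeasure_apply _ (measurable_mul_const (γ : G) hs)]
  exact lintegral_congr fun q => cosetMeasure_preimage_mul_right γ q hs

theorem unfoldedMeasure_le_of_injOn {s : Set G} (hs : MeasurableSet s)
    (h : s.InjOn ((↑) : G → G ⧸ Γ)) : unfoldedMeasure ν s ≤ ν Set.univ := by
  rw [unfoldedMeasure_apply _ hs, ← lintegral_one]
  exact lintegral_mono (cosetMeasure_le_one hs h)

theorem le_unfoldedMeasure_of_surjOn {s : Set G} (hs : MeasurableSet s)
    (h : s.SurjOn ((↑) : G → G ⧸ Γ) Set.univ) : ν Set.univ ≤ unfoldedMeasure ν s := by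
  rw [unfoldedMeasure_apply _ hs, ← lintegral_one]
  exact lintegral_mono (one_le_cosetMeasure hs h)

theorem isLatticeDomain_unfoldedMeasure [NeZero ν] [IsFiniteMeasure ν] {D : Set G}
    (hD : MeasurableSet D) (hbij : D.BijOn ((↑) : G → G ⧸ Γ) Set.univ) :
    IsLatticeDomain (unfoldedMeasure ν) Γ D where
  measurableSet := hD
  measure_ne_zero := ((Measure.measure_univ_pos.2 (NeZero.ne ν)).trans_le
    (le_unfoldedMeasure_of_surjOn ν hD hbij.surjOn)).ne'
  measure_ne_top := ((unfoldedMeasure_le_of_injOn ν hD hbij.injOn).trans_lt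
    (measure_lt_top ν _)).ne
  exists_mem z := by
    obtain ⟨d, hd, hdz⟩ := hbij.surjOn (Set.mem_univ (z : G ⧸ Γ))
    exact ⟨⟨d⁻¹ * z, QuotientGroup.eq.1 hdz⟩, by simpa using hd⟩
  eq_of_mem z γ γ' hγ hγ' := by
    have hcoset : ((z * (γ : G)⁻¹ : G) : G ⧸ Γ) = (z * (γ' : G)⁻¹ : G) :=
      (QuotientGroup.mk_mul_of_mem z (Γ.inv_mem γ.2)).trans
        (QuotientGroup.mk_mul_of_mem z (Γ.inv_mem γ'.2)).symm
    exact Subtype.ext (inv_injective (mul_left_cancel (hbij.injOn hγ hγ' hcoset)))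
  measurePreserving := measurePreserving_mul_right_unfoldedMeasure ν

end UnfoldedMeasure

section Transversals

theorem bijOn_iUnion_inter_preimage_disjointed {α β : Type*} {f : α → β} {V : ℕ → Set α}
    (hinj : ∀ n, (V n).InjOn f) (hcover : ⋃ n, f '' V n = Set.univ) :
    (⋃ n, V n ∩ f ⁻¹' disjointed (fun m => f '' V m) n).BijOn f Set.univ := by
  refine ⟨Set.mapsTo_univ _ _, fun x hx y hy hxy => ?_, fun y _ => ?_⟩
  · obtain ⟨n, hxV, hxn⟩ := Set.mem_iUnion.1 hx
    obtain ⟨m, hyV, hym⟩ := Set.mem_iUnion.1 hy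
    obtain rfl : n = m := by
      by_contra hnm
      refine Set.disjoint_left.1 (disjoint_disjointed (fun m => f '' V m) hnm) hxn ?_
      rwa [hxy]
    exact hinj n hxV hyV hxy
  · have hy : y ∈ ⋃ n, disjointed (fun m => f '' V m) n := by
      rw [iUnion_disjointed, hcover]
      exact Set.mem_univ y
    obtain ⟨n, hn⟩ := Set.mem_iUnion.1 hy
    obtain ⟨x, hx, rfl⟩ := disjointed_subset _ n hn
    exact ⟨x, Set.mem_iUnion.2 ⟨n, hx, hn⟩, rfl⟩

variable {G : Type u} [Group G]

theorem injOn_mk_preimage_mul_left {Γ : Subgroup G} {U : Set G} (hU : U.InjOn ((↑) : G → G ⧸ Γ))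
    (g : G) : ((fun z => g * z) ⁻¹' U).InjOn ((↑) : G → G ⧸ Γ) := fun _ hx _ hy hxy =>
  mul_left_cancel (hU hx hy (congrArg (g • ·) hxy))

variable [TopologicalSpace G] [IsTopologicalGroup G]

theorem exists_isOpen_injOn_mk (Γ : Subgroup G) [DiscreteTopology Γ] :
    ∃ U : Set G, IsOpen U ∧ (1 : G) ∈ U ∧ U.InjOn ((↑) : G → G ⧸ Γ) := by
  obtain ⟨V, hV, hVΓ⟩ := isOpen_induced_iff.1 (isOpen_discrete ({1} : Set Γ))
  have hmem : ∀ γ : Γ, (γ : G) ∈ V ↔ γ = 1 := fun γ => Set.ext_iff.1 hVΓ γ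
  have hcont : ContinuousAt (fun p : G × G => p.1⁻¹ * p.2) (1, 1) := by fun_prop
  obtain ⟨U, hU, hU1, hUV⟩ := exists_nhds_square
    (hcont.preimage_mem_nhds (hV.mem_nhds (by simpa using (hmem 1).2 rfl)))
  refine ⟨U, hU, hU1, fun x hx y hy hxy => ?_⟩
  have hquot : (⟨x⁻¹ * y, QuotientGroup.eq.1 hxy⟩ : Γ) = 1 :=
    (hmem _).1 (hUV (Set.mk_mem_prod hx hy))
  exact inv_mul_eq_one.1 (congrArg Subtype.val hquot)

variable [MeasurableSpace G] [BorelSpace G]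

theorem exists_measurableSet_bijOn_mk [SecondCountableTopology G] (Γ : Subgroup G)
    [DiscreteTopology Γ] :
    ∃ D : Set G, MeasurableSet D ∧ D.BijOn ((↑) : G → G ⧸ Γ) Set.univ := by
  obtain ⟨U, hU, hU1, hUΓ⟩ := exists_isOpen_injOn_mk Γ
  let g : ℕ → G := TopologicalSpace.denseSeq G
  let V : ℕ → Set G := fun n => (fun z => (g n)⁻¹ * z) ⁻¹' U
  have hVo : ∀ n, IsOpen (V n) := fun n => hU.preimage (continuous_const_mul _)
  have himage : ∀ n, MeasurableSet (((↑) : G → G ⧸ Γ) '' V n) := fun n =>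
    ((QuotientGroup.isOpenMap_coe _ (hVo n)).preimage QuotientGroup.continuous_mk).measurableSet
  refine ⟨_, MeasurableSet.iUnion fun n => (hVo n).measurableSet.inter
    (measurable_quotient_mk'' (MeasurableSet.disjointed himage n)),
    bijOn_iUnion_inter_preimage_disjointed
      (fun n => injOn_mk_preimage_mul_left hUΓ (g n)⁻¹) (Set.eq_univ_of_forall fun q => ?_)⟩
  induction q using QuotientGroup.induction_on with | H z => ?_
  obtain ⟨n, hn⟩ := (TopologicalSpace.denseRange_denseSeq G).exists_mem_open
    (hU.preimage (by fun_prop : Continuous fun x : G => x⁻¹ * z)) ⟨z, by simpa using hU1⟩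
  exact Set.mem_iUnion.2 ⟨n, z, hn, rfl⟩

theorem isLocallyFiniteMeasure_unfoldedMeasure {Γ : Subgroup G} [DiscreteTopology Γ] [Countable Γ]
    (ν : Measure (G ⧸ Γ)) [IsFiniteMeasure ν] [SMulInvariantMeasure G (G ⧸ Γ) ν] :
    IsLocallyFiniteMeasure (unfoldedMeasure ν) := by
  have := isMulLeftInvariant_unfoldedMeasure ν
  obtain ⟨U, hU, hU1, hUΓ⟩ := exists_isOpen_injOn_mk Γ
  refine ⟨fun x => ⟨(fun z => x⁻¹ * z) ⁻¹' U,
    (hU.preimage (continuous_const_mul _)).mem_nhds (by simpa using hU1), ?_⟩⟩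
  rw [measure_preimage_mul]
  exact (unfoldedMeasure_le_of_injOn ν hU.measurableSet hUΓ).trans_lt (measure_lt_top _ _)

end Transversals

section LatticeDomainExistence

theorem IsLatticeDomain.of_smul {G : Type u} [Group G] [MeasurableSpace G] {μ : Measure G}
    {Γ : Subgroup G} {D : Set G} {c : NNReal} (hD : IsLatticeDomain (c • μ) Γ D) :
    IsLatticeDomain μ Γ D := by
  have hc : c ≠ 0 := by
    rintro rfl
    exact hD.measure_ne_zero (by simp)
  refine ⟨hD.measurableSet, fun h => hD.measure_ne_zero ?_, fun h => hD.measure_ne_top ?_,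
    hD.exists_mem, hD.eq_of_mem, fun γ => ?_⟩
  · rw [Measure.smul_apply, h, smul_zero]
  · rw [Measure.smul_apply, h, ENNReal.smul_def, smul_eq_mul,
      ENNReal.mul_top (ENNReal.coe_ne_zero.2 hc)]
  · simpa [smul_smul, hc] using (hD.measurePreserving γ).smul_measure c⁻¹

theorem IsGroupLattice.exists_isLatticeDomain {G : Type u} [Group G] [TopologicalSpace G]
    [IsTopologicalGroup G] [LocallyCompactSpace G] [SecondCountableTopology G]
    [MeasurableSpace G] [BorelSpace G] (μ : Measure G) [μ.IsHaarMeasure] {Γ : Subgroup G}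
    (hΓ : IsGroupLattice Γ) : ∃ D, IsLatticeDomain μ Γ D := by
  have := hΓ.discrete
  have : Countable Γ := TopologicalSpace.separableSpace_iff_countable.1 inferInstance
  obtain ⟨ν, hν, _, _⟩ := hΓ.exists_measure
  have : NeZero ν := ⟨hν⟩
  have := isMulLeftInvariant_unfoldedMeasure ν
  have := isLocallyFiniteMeasure_unfoldedMeasure ν
  obtain ⟨D, hDm, hDbij⟩ := exists_measurableSet_bijOn_mk Γ
  refine ⟨D, .of_smul (c := (unfoldedMeasure ν).haarScalarFactor μ) ?_⟩
  rw [← Measure.isMulLeftInvariant_eq_smul]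
  exact isLatticeDomain_unfoldedMeasure ν hDm hDbij

end LatticeDomainExistence

section DiscreteGroups

variable {Λ : Type u} [Group Λ] [MeasurableSpace Λ]

theorem isLatticeDomain_count [MeasurableMul Λ] [MeasurableSingletonClass Λ] :
    IsLatticeDomain (Measure.count : Measure Λ) ⊤ {1} where
  measurableSet := measurableSet_singleton _
  measure_ne_zero := by simp
  measure_ne_top := by simp
  exists_mem z := ⟨⟨z, trivial⟩, by simp⟩
  eq_of_mem z γ γ' h h' := by
    rw [Set.mem_singleton_iff, mul_inv_eq_one] at h h'
    exact Subtype.ext (h.symm.trans h')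
  measurePreserving γ := measurePreserving_mul_right _ _

theorem isHaarMeasure_count [TopologicalSpace Λ] [DiscreteTopology Λ] [BorelSpace Λ] :
    (Measure.count : Measure Λ).IsHaarMeasure where
  lt_top_of_isCompact _ hK := Measure.count_apply_lt_top.2 hK.finite_of_discrete
  open_pos _ _ hne h := hne.ne_empty (Measure.count_eq_zero_iff.1 h)

end DiscreteGroups

end

theorem theorem2p3 {G : Type u} [Group G] [TopologicalSpace G] [IsTopologicalGroup G]
    [T2Space G] [LocallyCompactSpace G] [SecondCountableTopology G]
    [MeasurableSpace G] [BorelSpace G]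
    (μ : Measure G) [μ.IsHaarMeasure]
    (Γ : Subgroup G) (hΓ : IsGroupLattice Γ) (k : ℝ) (hk : 1 ≤ k) :
    HasCBApproximateUnit μ k ↔ HasCBApproximateUnit (Measure.count : Measure Γ) k := by
  have := hΓ.discrete
  have : Countable Γ := TopologicalSpace.separableSpace_iff_countable.1 inferInstance
  have := isHaarMeasure_count (Λ := Γ)
  have hk' : 0 < k := zero_lt_one.trans_le hk
  constructor
  · intro h
    exact isLatticeDomain_count.hasCBApproximateUnit hk'.le
      ((h.hasFiniteHerzSchurApproximation hk' hΓ.isClosed).congr Subgroup.topEquiv)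
  · intro h
    obtain ⟨D, hD⟩ := hΓ.exists_isLatticeDomain μ
    exact hD.hasCBApproximateUnit hk'.le
      ((h.hasFiniteHerzSchurApproximation (Γ := ⊤) hk' isClosed_univ).congr
        Subgroup.topEquiv.symm)
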